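/- Write $\langle x\rangle=(1+x^2)^{1/2}$. Let $k\ge 2$ be real and let $V\in C^\infty(\mathbb R,[0,\infty))$ satisfy: (i) there is $C>1$ with $\frac1C\langle x\rangle^k\le V(x)\le C\langle x\rangle^k$ for $|x|\ge 1$; (ii) for every integer $j\ge 0$ there is $C_j>0$ with $|V^{(j)}(x)|\le C_j\langle x\rangle^{k-j}$ for all $x\in\mathbb R$; (iii) $V(x)\sim c\,\langle x\rangle^k$ for some constant $c>0$, that is, $V(x)/\langle x\rangle^k\to c$ as $|x|\to\infty$. Let $H=-\frac{d^2}{dx^2}+V$ be the self-adjoint realization on $L^2(\mathbb R)$ (so $Hu=w$ means that $u,w\in L^2(\mathbb R)$ and $-u''+Vu=w$ in the sense of distributions), and let $(\phi_n)_{n\ge 1}$ be a Hilbert basis of $L^2(\mathbb R)$ with $H\phi_n=\lambda_n^2\phi_n$, $\lambda_n\ge 0$. Let $\gamma>0$ and let $\Psi:\mathbb R\to\mathbb R$ be continuous. Then the following are equivalent. (a) There is $C>0$ such that $$\Big(\int_0^{2\pi}\big\|\Psi\,\langle H\rangle^{\gamma/2}e^{-itH}f\big\|_{L^2(\mathbb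 R)}^2\,dt\Big)^{1/2}\le C\,\|f\|_{L^2(\mathbb R)}\qquad\text{for all } f\in L^2(\mathbb R).$$ (b) There is $C>0$ such that $\|\Psi\phi_n\|_{L^2(\mathbb R)}\le C\,\lambda_n^{-\gamma}$ for all $n\ge 1$. Here $\langle H\rangle=(1+H^2)^{1/2}$, and for $f=\sum_n\alpha_n\phi_n\in L^2(\mathbb R)$ the function in (a) is $\Psi\langle H\rangle^{\gamma/2}e^{-itH}f=\sum_n\langle\lambda_n^2\rangle^{\gamma/2}e^{-it\lambda_n^2}\alpha_n\,\Psi\phi_n$; statement (a) includes the unconditional convergence of this series in $L^2((0,2\pi);L^2(\mathbb R))$. -/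

import Mathlib

open MeasureTheory Filter Topology
open scoped ENNReal ContDiff

noncomputable section

namespace Smoothing

/-- The Japanese bracket `⟨x⟩ = (1 + x²)^(1/2)`. -/
def bracket (x : ℝ) : ℝ := Real.sqrt (1 + x ^ 2)

/-- The Hilbert space `L²(ℝ)` of complex valued functions. -/
abbrev L2 : Type := Lp ℂ 2 (volume : Measure ℝ)

/-- Smooth, nonnegative, confining potentials of order `k ≥ 2` on the line. -/
structure IsConfining (V : ℝ → ℝ) (k : ℝ) : Prop where
  two_le : 2 ≤ k
  smooth : ContDiff ℝ ∞ V
  nonneg : ∀ x, 0 ≤ V x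
  growth : ∃ C : ℝ, 1 < C ∧ ∀ x : ℝ, 1 ≤ |x| →
    1 / C * bracket x ^ k ≤ V x ∧ V x ≤ C * bracket x ^ k
  symbol : ∀ j : ℕ, ∃ C : ℝ, 0 < C ∧ ∀ x : ℝ,
    |iteratedDeriv j V x| ≤ C * bracket x ^ (k - j)

/-- `V(x) ∼ c ⟨x⟩^k` as `|x| → ∞`, for some constant `c > 0`. -/
def IsAsymptoticToPower (V : ℝ → ℝ) (k : ℝ) : Prop :=
  ∃ c : ℝ, 0 < c ∧ Tendsto (fun x : ℝ => V x / bracket x ^ k) (cocompact ℝ) (𝓝 c)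

/-- The graph of the self-adjoint operator `H = -d²/dx² + V` on `L²(ℝ)`: `u` lies in the domain
of `H` and `H u = w`. The operator is the adjoint of its restriction to `C_c^∞(ℝ)`, that is,
`-u'' + V u = w` holds in the sense of distributions with `u, w ∈ L²(ℝ)`. For smooth `V ≥ 0` this is
the unique self-adjoint extension of `-d²/dx² + V` from `C_c^∞(ℝ)`. -/
def SchrodingerGraph (V : ℝ → ℝ) (u w : L2) : Prop :=
  ∀ η : ℝ → ℂ, ContDiff ℝ ∞ η → HasCompactSupport η →
    ∫ x, u x * (-(deriv (deriv η) x) + (V x : ℂ) * η x) = ∫ x, w x * η x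

/-- `(φ n)` is a Hilbert basis of `L²(ℝ)` made of eigenfunctions, `H (φ n) = (lam n)² φ n`,
with `lam n ≥ 0`. -/
structure IsEigenbasis (V : ℝ → ℝ) (φ : HilbertBasis ℕ ℂ L2) (lam : ℕ → ℝ) : Prop where
  nonneg : ∀ n, 0 ≤ lam n
  eigen : ∀ n, SchrodingerGraph V (φ n) (((lam n ^ 2 : ℝ) : ℂ) • φ n)

/-- The value at `(t, x)` of `⟨H⟩^(γ/2) e^{-itH}` applied to the part
`∑_{n ∈ s} α_n φ_n` of `f = ∑ α_n φ_n`, where `⟨H⟩ = (1 + H²)^(1/2)`; that is,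
`∑_{n ∈ s} ⟨λ_n²⟩^(γ/2) e^{-itλ_n²} α_n φ_n(x)`. -/
def partialFlow (φ : HilbertBasis ℕ ℂ L2) (lam : ℕ → ℝ) (γ : ℝ) (f : L2)
    (s : Finset ℕ) (t x : ℝ) : ℂ :=
  ∑ n ∈ s, ((bracket (lam n ^ 2) ^ (γ / 2) : ℝ) : ℂ)
    * Complex.exp (-(Complex.I * (t : ℂ) * ((lam n ^ 2 : ℝ) : ℂ))) * φ.repr f n * φ n x

/-- `U(t, x)` is (a representative of) `Ψ(x) (⟨H⟩^(γ/2) e^{-itH} f)(x)` on `(0, 2π) × ℝ`: the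
spectral expansion, multiplied by `Ψ`, converges to `U` unconditionally in
`L²((0, 2π); L²(ℝ))`. -/
def IsWeightedFlow (φ : HilbertBasis ℕ ℂ L2) (lam : ℕ → ℝ) (γ : ℝ) (Ψ : ℝ → ℝ) (f : L2)
    (U : ℝ → ℝ → ℂ) : Prop :=
  AEStronglyMeasurable (Function.uncurry U)
    (((volume : Measure ℝ).restrict (Set.Ioo 0 (2 * Real.pi))).prod (volume : Measure ℝ)) ∧
  Tendsto (fun s : Finset ℕ =>
      ∫⁻ t in Set.Ioo 0 (2 * Real.pi),
        eLpNorm (fun x => (Ψ x : ℂ) * partialFlow φ lam γ f s t x - U t x) 2 volume ^ 2)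
    atTop (𝓝 0)

/-- The smoothing estimate: there is `C` such that for all `f ∈ L²(ℝ)`, the function
`Ψ ⟨H⟩^(γ/2) e^{-itH} f` is in `L²((0, 2π); L²(ℝ))`, with norm at most `C ‖f‖`. -/
def SmoothingEstimate (φ : HilbertBasis ℕ ℂ L2) (lam : ℕ → ℝ) (γ : ℝ) (Ψ : ℝ → ℝ) : Prop :=
  ∃ C : ℝ, 0 < C ∧ ∀ f : L2, ∃ U : ℝ → ℝ → ℂ, IsWeightedFlow φ lam γ Ψ f U ∧
    (∫⁻ t in Set.Ioo 0 (2 * Real.pi), eLpNorm (U t) 2 volume ^ 2) ^ (1 / 2 : ℝ)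
      ≤ ENNReal.ofReal (C * ‖f‖)

/-- Decay of the individual eigenfunctions: `‖Ψ φ_n‖_{L²} ≤ C λ_n^(-γ)` for all `n`
(in particular every `Ψ φ_n` is in `L²`). -/
def EigenfunctionDecay (φ : HilbertBasis ℕ ℂ L2) (lam : ℕ → ℝ) (γ : ℝ) (Ψ : ℝ → ℝ) : Prop :=
  ∃ C : ℝ, 0 < C ∧ ∀ n : ℕ,
    eLpNorm (fun x => (Ψ x : ℂ) * φ n x) 2 volume ≤ ENNReal.ofReal (C * lam n ^ (-γ))

end Smoothing

end

/-!
By the expansion `f = ∑ α_n φ_n`, the estimate for `f = φ_n` is the decay of `‖Ψ φ_n‖`, because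
`|e^{-itλ}| = 1` and `⟨λ_n²⟩^(γ/2) ≥ λ_n^γ`, where `λ_n > 0` since `|φ|²` is convex for a solution
of `φ'' = V φ` (`SmoothingEstimate.eigenfunctionDecay`). The converse
(`EigenfunctionDecay.smoothingEstimate`) needs the exponentials `e^{-itλ_n²}` to be almost
orthogonal on `(0, 2π)`. A Gaussian majorant of the interval and Schur's test give this as soon as
the number of eigenvalues `λ_n²` in a window of fixed width is bounded
(`exists_exponential_sum_bound`, `exists_sum_gaussian_le`). Almost orthogonality is applied for
fixed `x` with coefficients `⟨λ_n²⟩^(γ/2) α_n Ψ(x) φ_n(x)` and then integrated in `x`.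

The spectral input is that a short window around any `E ≥ 0` contains at most two eigenvalues
(`IsEigenbasis.exists_window`). Three eigenfunctions have a nontrivial combination `u` with
`u(0) = u'(0) = 0`, and `f = (H - E) u` is small compared with `u` if the window is short. This
contradicts the bound `‖u‖ ≤ C ‖f‖` on each half line, with `C` independent of `E`
(`GrowsLikePower.exists_apriori_bound`). For large `E` that bound comes from the multiplier `a u'`:
the identity
`∫ a' |u'|² + ∫ (a' (E - V) - a V') |u|² = 2 Re ∫ a f ū'` has a coefficient of size `E` in front of
`|u|²` when `a(x) = -(2A - min(x, A))` with `A` a small multiple of the turning point `E^(1/k)`,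
because `V' ≥ c x^(k-1)` for large `x`. The size of `a` is harmless because `A ≤ C E^(1/2)`, which
is where `k ≥ 2` is used. For bounded `E` the bound is Gronwall's inequality together with the
positivity of `V - E` far out. The lower bound on `V'` follows from `V ∼ c ⟨x⟩^k` and the bound on
`V''` (`growsLikePower_of_tendsto`).

The eigenvalue equation is given in the sense of distributions; a second order version of the
du Bois-Reymond lemma makes its solutions classical (`exists_classical_of_weak`).
-/

namespace Smoothing

/-! ### Weak solutions are classical -/

theorem exists_forall_eq_zero_of_le_abs {η : ℝ → ℝ} (hs : HasCompactSupport η) :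
    ∃ M : ℝ, 0 < M ∧ ∀ x, M ≤ |x| → η x = 0 := by
  obtain ⟨r, hr⟩ := hs.isCompact.isBounded.subset_closedBall 0
  refine ⟨max r 0 + 1, by positivity, fun x hx => ?_⟩
  by_contra h
  have := hr (subset_tsupport _ h)
  rw [mem_closedBall_zero_iff, Real.norm_eq_abs] at this
  linarith [le_max_left r 0]

theorem integral_eq_intervalIntegral {f : ℝ → ℝ} {M : ℝ} (h : ∀ x, M ≤ |x| → f x = 0) :
    ∫ x, f x = ∫ x in (-M)..M, f x := by
  refine (intervalIntegral.integral_eq_integral_of_support_subset fun x hx => ?_).symm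
  by_contra hx'
  refine hx (h x ?_)
  rw [Set.mem_Ioc, not_and_or, not_lt, not_le] at hx'
  rcases hx' with h1 | h1
  · exact le_abs.2 (Or.inr (by linarith))
  · exact le_abs.2 (Or.inl h1.le)

theorem intervalIntegrable_of_locallyIntegrable {g : ℝ → ℝ} (hg : LocallyIntegrable g) (a b : ℝ) :
    IntervalIntegrable g volume a b :=
  (hg.integrableOn_isCompact isCompact_uIcc).intervalIntegrable

/-- Integration by parts against a test function, for the primitive of a locally integrable
function. -/
theorem integral_primitive_mul_deriv {g η : ℝ → ℝ} (hg : LocallyIntegrable g)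
    (hη : ContDiff ℝ ∞ η) (hs : HasCompactSupport η) :
    ∫ x, (∫ t in (0 : ℝ)..x, g t) * deriv η x = -∫ x, g x * η x := by
  obtain ⟨M, hM, hM0⟩ := exists_forall_eq_zero_of_le_abs hs
  obtain ⟨M', hM', hM0'⟩ := exists_forall_eq_zero_of_le_abs hs.deriv
  have key : ∀ K, M ≤ K → M' ≤ K →
      ∫ x, (∫ t in (0 : ℝ)..x, g t) * deriv η x = -∫ x, g x * η x := by
    intro K h1 h2
    rw [integral_eq_intervalIntegral (M := K) fun x hx => by simp [hM0' x (h2.trans hx)],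
      integral_eq_intervalIntegral (M := K) fun x hx => by simp [hM0 x (h1.trans hx)]]
    have hgi : IntervalIntegrable g volume (-K) K :=
      intervalIntegrable_of_locallyIntegrable hg _ _
    have hac := hgi.absolutelyContinuousOnInterval_intervalIntegral (c := 0)
      (Set.mem_uIcc_of_le (by linarith) (by linarith))
    have hηac : AbsolutelyContinuousOnInterval η (-K) K :=
      (hη.of_le (by norm_cast) : ContDiff ℝ 1 η).contDiffOn.absolutelyContinuousOnInterval
    rw [hac.integral_mul_deriv_eq_deriv_mul hηac,
      hM0 K (by rw [abs_of_nonneg (by linarith)]; exact h1),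
      hM0 (-K) (by rw [abs_neg, abs_of_nonneg (by linarith)]; exact h1)]
    simp only [mul_zero, sub_zero, zero_sub, neg_inj]
    refine intervalIntegral.integral_congr_ae ?_
    filter_upwards [hgi.ae_hasDerivAt_integral] with x hx hx'
    rw [(hx (Set.uIoc_subset_uIcc hx') 0
      (Set.mem_uIcc_of_le (by linarith) (by linarith))).deriv]
  exact key (max M M') (le_max_left _ _) (le_max_right _ _)

/-- A test function with integral `0` is the derivative of a test function. -/
theorem exists_primitive_test {ψ : ℝ → ℝ} (hψ : ContDiff ℝ ∞ ψ) (hs : HasCompactSupport ψ)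
    (h0 : ∫ x, ψ x = 0) :
    ∃ η : ℝ → ℝ, ContDiff ℝ ∞ η ∧ HasCompactSupport η ∧ deriv η = ψ := by
  obtain ⟨M, hM, hM0⟩ := exists_forall_eq_zero_of_le_abs hs
  have hd : ∀ x, HasDerivAt (fun x => ∫ t in (-M)..x, ψ t) (ψ x) x := fun x =>
    intervalIntegral.integral_hasDerivAt_right (hψ.continuous.intervalIntegrable _ _)
      (hψ.continuous.stronglyMeasurableAtFilter _ _) hψ.continuous.continuousAt
  have hdd : deriv (fun x => ∫ t in (-M)..x, ψ t) = ψ := funext fun x => (hd x).deriv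
  refine ⟨fun x => ∫ t in (-M)..x, ψ t, ?_, ?_, hdd⟩
  · rw [contDiff_infty_iff_deriv, hdd]
    exact ⟨fun x => (hd x).differentiableAt, hψ⟩
  · refine HasCompactSupport.intro (isCompact_Icc (a := -M) (b := M)) fun x hx => ?_
    rw [Set.mem_Icc, not_and_or, not_le, not_le] at hx
    rcases hx with hx | hx
    · refine (intervalIntegral.integral_congr (g := fun _ => (0 : ℝ)) fun t ht => ?_).trans
        (by simp)
      rw [Set.uIcc_of_ge hx.le] at ht
      exact hM0 t (le_abs.2 (Or.inr (by linarith [ht.2])))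
    · rw [← h0, integral_eq_intervalIntegral (M := x) fun t ht => hM0 t (hx.le.trans ht)]
      have := intervalIntegral.integral_add_adjacent_intervals
        (hψ.continuous.intervalIntegrable (μ := volume) (-x) (-M))
        (hψ.continuous.intervalIntegrable (-M) x)
      rw [← this, eq_comm, add_eq_right]
      refine (intervalIntegral.integral_congr (g := fun _ => (0 : ℝ)) fun t ht => ?_).trans
        (by simp)
      rw [Set.uIcc_of_le (by linarith)] at ht
      exact hM0 t (le_abs.2 (Or.inr (by linarith [ht.2])))

theorem exists_test_integral_eq_one :
    ∃ ρ : ℝ → ℝ, ContDiff ℝ ∞ ρ ∧ HasCompactSupport ρ ∧ ∫ x, ρ x = 1 := by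
  let b : ContDiffBump (0 : ℝ) := ⟨1, 2, by norm_num, by norm_num⟩
  exact ⟨b.normed volume, b.contDiff_normed, b.hasCompactSupport_normed, b.integral_normed⟩

theorem integrable_mul_test {v η : ℝ → ℝ} (hv : LocallyIntegrable v) (hη : Continuous η)
    (hs : HasCompactSupport η) : Integrable fun x => v x * η x := by
  have := hv.integrable_smul_right_of_hasCompactSupport hη hs
  simpa [mul_comm] using this

/-- A locally integrable function whose second distributional derivative vanishes is affine. -/
theorem ae_eq_affine_of_integral_deriv_deriv_eq_zero {v : ℝ → ℝ} (hv : LocallyIntegrable v)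
    (h : ∀ η : ℝ → ℝ, ContDiff ℝ ∞ η → HasCompactSupport η → ∫ x, v x * deriv (deriv η) x = 0) :
    ∃ a b : ℝ, ∀ᵐ x, v x = a + b * x := by
  obtain ⟨ρ, hρ, hρs, hρ1⟩ := exists_test_integral_eq_one
  have hρ' : ContDiff ℝ ∞ (deriv ρ) := (contDiff_infty_iff_deriv.1 hρ).2
  have hρd : ∀ x, HasDerivAt ρ (deriv ρ x) x := fun x =>
    ((contDiff_infty_iff_deriv.1 hρ).1 x).hasDerivAt
  -- the affine function is the one with the same integrals as `v` against `ρ` and `ρ'`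
  set b : ℝ := -∫ x, v x * deriv ρ x with hb
  set a : ℝ := (∫ x, v x * ρ x) - b * ∫ x, x * ρ x with ha
  refine ⟨a, b, ?_⟩
  have hℓ : Continuous fun x : ℝ => a + b * x := by fun_prop
  refine ae_eq_of_integral_contDiff_smul_eq hv hℓ.locallyIntegrable fun ψ hψ hψs => ?_
  have hc := hψ.continuous
  have hρc := hρ.continuous
  set m := ∫ x, ψ x with hm
  have hψi : Integrable ψ := hc.integrable_of_hasCompactSupport hψs
  have hρi : Integrable ρ := hρc.integrable_of_hasCompactSupport hρs
  obtain ⟨ψ₁, h1, h1s, h1d⟩ := exists_primitive_test (ψ := fun x => ψ x - m * ρ x)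
    (hψ.sub (contDiff_const.mul hρ)) (hψs.sub hρs.mul_left)
    (by rw [integral_sub hψi (hρi.const_mul m), integral_const_mul, hρ1, ← hm]; ring)
  have h1i : Integrable ψ₁ := h1.continuous.integrable_of_hasCompactSupport h1s
  set m₁ := ∫ x, ψ₁ x with hm1
  obtain ⟨ψ₂, h2, h2s, h2d⟩ := exists_primitive_test (ψ := fun x => ψ₁ x - m₁ * ρ x)
    (h1.sub (contDiff_const.mul hρ)) (h1s.sub hρs.mul_left)
    (by rw [integral_sub h1i (hρi.const_mul m₁), integral_const_mul, hρ1, ← hm1]; ring)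
  have h2dd : deriv (deriv ψ₂) = fun x => ψ x - m * ρ x - m₁ * deriv ρ x := by
    rw [h2d]
    funext x
    have : HasDerivAt ψ₁ (ψ x - m * ρ x) x := by
      have := ((contDiff_infty_iff_deriv.1 h1).1 x).hasDerivAt
      rwa [h1d] at this
    exact (this.sub ((hρd x).const_mul m₁)).deriv
  -- a function with vanishing second derivative pairs with `ψ` through its pairings with `ρ`, `ρ'`
  have pair : ∀ w : ℝ → ℝ, LocallyIntegrable w → ∫ x, w x * deriv (deriv ψ₂) x = 0 →
      ∫ x, ψ x • w x = m * (∫ x, w x * ρ x) + m₁ * ∫ x, w x * deriv ρ x := by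
    intro w hw h0
    have i1 := integrable_mul_test hw hc hψs
    have i2 := (integrable_mul_test hw hρc hρs).const_mul m
    have i3 := (integrable_mul_test hw hρ'.continuous hρs.deriv).const_mul m₁
    have : ∀ x, w x * deriv (deriv ψ₂) x =
        w x * ψ x - m * (w x * ρ x) - m₁ * (w x * deriv ρ x) := fun x => by rw [h2dd]; ring
    simp_rw [this] at h0
    rw [integral_sub (by exact i1.sub i2) i3, integral_sub i1 i2, integral_const_mul,
      integral_const_mul] at h0
    simp_rw [smul_eq_mul, mul_comm (ψ _)]
    linarith
  have parts : ∀ η : ℝ → ℝ, ContDiff ℝ ∞ η → HasCompactSupport η →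
      ∫ x, (a + b * x) * deriv η x = -(b * ∫ x, η x) := by
    intro η hη hηs
    have hη' := (contDiff_infty_iff_deriv.1 hη).2.continuous
    have := integral_mul_deriv_eq_deriv_mul_of_integrable (u := fun x : ℝ => a + b * x)
      (u' := fun _ => b) (v := η) (v' := deriv η)
      (fun x _ => by simpa using ((hasDerivAt_id x).const_mul b).const_add a)
      (fun x _ => ((contDiff_infty_iff_deriv.1 hη).1 x).hasDerivAt)
      (integrable_mul_test hℓ.locallyIntegrable hη' hηs.deriv)
      (integrable_mul_test continuous_const.locallyIntegrable hη.continuous hηs)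
      (integrable_mul_test hℓ.locallyIntegrable hη.continuous hηs)
    rw [this, integral_const_mul]
  have h3 : ∫ x, deriv ψ₂ x = 0 := by
    rw [h2d, integral_sub h1i (hρi.const_mul m₁), integral_const_mul, hρ1, ← hm1]; ring
  rw [pair v hv (h ψ₂ h2 h2s), pair _ hℓ.locallyIntegrable
    (by rw [parts _ (contDiff_infty_iff_deriv.1 h2).2 h2s.deriv, h3]; ring), parts ρ hρ hρs, hρ1]
  have h4 : ∫ x, (a + b * x) * ρ x = a + b * ∫ x, x * ρ x := by
    have i1 := hρi.const_mul a
    have i2 := (integrable_mul_test (v := fun x => x) continuous_id.locallyIntegrable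
      hρc hρs).const_mul b
    simp_rw [add_mul, mul_assoc]
    rw [integral_add i1 i2, integral_const_mul, integral_const_mul, hρ1]; ring
  rw [h4, ha, hb]
  ring

/-- Weak solutions of `v'' = q v` with a continuous coefficient `q` are classical solutions. -/
theorem exists_classical_of_weak {v q : ℝ → ℝ} (hv : LocallyIntegrable v) (hq : Continuous q)
    (h : ∀ η : ℝ → ℝ, ContDiff ℝ ∞ η → HasCompactSupport η →
      ∫ x, v x * (-(deriv (deriv η) x) + q x * η x) = 0) :
    ∃ u u' : ℝ → ℝ, u =ᵐ[volume] v ∧ (∀ x, HasDerivAt u (u' x) x) ∧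
      ∀ x, HasDerivAt u' (q x * u x) x := by
  have hg : LocallyIntegrable fun x => v x * q x := LocallyIntegrable.mul_continuous hq hv
  set G : ℝ → ℝ := fun x => ∫ t in (0 : ℝ)..x, v t * q t with hG
  have hGc : Continuous G :=
    intervalIntegral.continuous_primitive (intervalIntegrable_of_locallyIntegrable hg) 0
  set W : ℝ → ℝ := fun x => ∫ t in (0 : ℝ)..x, G t with hW
  have hWd : ∀ x, HasDerivAt W (G x) x := fun x =>
    intervalIntegral.integral_hasDerivAt_right (hGc.intervalIntegrable _ _)
      (hGc.stronglyMeasurableAtFilter _ _) hGc.continuousAt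
  have hWc : Continuous W := continuous_iff_continuousAt.2 fun x => (hWd x).continuousAt
  obtain ⟨a, b, hab⟩ := ae_eq_affine_of_integral_deriv_deriv_eq_zero
    (v := fun x => v x - W x) (hv.sub hWc.locallyIntegrable) (by
      intro η hη hs
      obtain ⟨-, hη'⟩ := contDiff_infty_iff_deriv.1 hη
      obtain ⟨-, hη''⟩ := contDiff_infty_iff_deriv.1 hη'
      have i1 := integrable_mul_test hv hη''.continuous hs.deriv.deriv
      have i2 := integrable_mul_test hg hη.continuous hs
      have i3 := integrable_mul_test hWc.locallyIntegrable hη''.continuous hs.deriv.deriv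
      have e1 := h η hη hs
      have : ∀ x, v x * (-(deriv (deriv η) x) + q x * η x) =
        v x * q x * η x - v x * deriv (deriv η) x := fun x => by ring
      simp_rw [this] at e1
      rw [integral_sub i2 i1] at e1
      have e2 := integral_primitive_mul_deriv hg hη hs
      have e3 := integral_primitive_mul_deriv hGc.locallyIntegrable hη' hs.deriv
      simp_rw [sub_mul]
      rw [integral_sub i1 i3]
      linarith)
  refine ⟨fun x => W x + (a + b * x), fun x => G x + b, ?_, fun x => ?_, fun x => ?_⟩
  · filter_upwards [hab] with x hx
    linarith
  · have : HasDerivAt (fun x : ℝ => a + b * x) b x := by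
      simpa using ((hasDerivAt_id x).const_mul b).const_add a
    exact (hWd x).add this
  · have hGe : G = fun x => ∫ t in (0 : ℝ)..x, q t * (W t + (a + b * t)) := by
      funext x
      refine intervalIntegral.integral_congr_ae ?_
      filter_upwards [hab] with t ht _
      rw [← ht]; ring
    have hc : Continuous fun t => q t * (W t + (a + b * t)) := by fun_prop
    have : HasDerivAt G (q x * (W x + (a + b * x))) x := by
      rw [hGe]
      exact intervalIntegral.integral_hasDerivAt_right (hc.intervalIntegrable _ _)
        (hc.stronglyMeasurableAtFilter _ _) hc.continuousAt
    exact this.add_const b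

/-! ### Eigenfunctions are classical -/

/-- Eigenfunctions of `-d²/dx² + V` in the sense of distributions are classical eigenfunctions. -/
theorem SchrodingerGraph.exists_classical {V : ℝ → ℝ} (hV : Continuous V) {u : L2} {μ : ℝ}
    (h : SchrodingerGraph V u ((μ : ℂ) • u)) :
    ∃ w w' : ℝ → ℂ, w =ᵐ[volume] u ∧ (∀ x, HasDerivAt w (w' x) x) ∧
      ∀ x, HasDerivAt w' ((V x - μ) • w x) x := by
  have hu : LocallyIntegrable (u : ℝ → ℂ) := (Lp.memLp u).locallyIntegrable (by norm_num)
  have hint : ∀ ζ : ℝ → ℝ, Continuous ζ → HasCompactSupport ζ →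
      Integrable fun x => u x * (ζ x : ℂ) := fun ζ hζ hs => by
    have := hu.integrable_smul_left_of_hasCompactSupport hζ hs
    simpa [mul_comm] using this
  have key : ∀ η : ℝ → ℝ, ContDiff ℝ ∞ η → HasCompactSupport η →
      Integrable (fun x => u x * ((-(deriv (deriv η) x) + (V x - μ) * η x : ℝ) : ℂ)) ∧
      ∫ x, u x * ((-(deriv (deriv η) x) + (V x - μ) * η x : ℝ) : ℂ) = 0 := by
    intro η hη hs
    obtain ⟨hd, hη'⟩ := contDiff_infty_iff_deriv.1 hη
    obtain ⟨hd', hη''⟩ := contDiff_infty_iff_deriv.1 hη'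
    have hc : HasCompactSupport fun x => (η x : ℂ) :=
      hs.comp_left (g := fun y : ℝ => (y : ℂ)) Complex.ofReal_zero
    have e := h (fun x => (η x : ℂ)) (Complex.ofRealCLM.contDiff.comp hη) hc
    have d1 : deriv (fun x => (η x : ℂ)) = fun x => ((deriv η x : ℝ) : ℂ) :=
      funext fun x => (hd x).hasDerivAt.ofReal_comp.deriv
    have d2 : deriv (fun x => ((deriv η x : ℝ) : ℂ)) = fun x => ((deriv (deriv η) x : ℝ) : ℂ) :=
      funext fun x => (hd' x).hasDerivAt.ofReal_comp.deriv
    rw [d1, d2] at e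
    have i1 := hint (fun x => -(deriv (deriv η) x) + V x * η x)
      (hη''.continuous.neg.add (hV.mul hη.continuous)) (hs.deriv.deriv.neg.add hs.mul_left)
    have i2 := (hint η hη.continuous hs).const_mul (μ : ℂ)
    have e2 : ∫ x, ((μ : ℂ) • u : L2) x * (η x : ℂ) = ∫ x, (μ : ℂ) * (u x * (η x : ℂ)) := by
      refine integral_congr_ae ?_
      filter_upwards [Lp.coeFn_smul (μ : ℂ) u] with x hx
      rw [hx, Pi.smul_apply, smul_eq_mul, mul_assoc]
    rw [e2] at e
    have e3 : (fun x => u x * ((-(deriv (deriv η) x) + (V x - μ) * η x : ℝ) : ℂ)) =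
        fun x => u x * ((-(deriv (deriv η) x) + V x * η x : ℝ) : ℂ) - μ * (u x * (η x : ℂ)) := by
      funext x; push_cast; ring
    rw [e3]
    refine ⟨i1.sub i2, ?_⟩
    rw [integral_sub i1 i2, ← e, sub_eq_zero]
    push_cast
    rfl
  have hVμ : Continuous fun x => V x - μ := hV.sub continuous_const
  have hre : LocallyIntegrable fun x => (u x).re := fun x =>
    (hu x).imp fun _ hs => ⟨hs.1, hs.2.re⟩
  have him : LocallyIntegrable fun x => (u x).im := fun x =>
    (hu x).imp fun _ hs => ⟨hs.1, hs.2.im⟩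
  obtain ⟨a, a', ha, had, had'⟩ := exists_classical_of_weak hre hVμ fun η hη hs => by
    obtain ⟨hi, h0⟩ := key η hη hs
    have := Complex.reCLM.integral_comp_comm hi
    rw [h0] at this
    simpa [-Complex.ofReal_add, -Complex.ofReal_mul, Complex.mul_re] using this
  obtain ⟨b, b', hb, hbd, hbd'⟩ := exists_classical_of_weak him hVμ fun η hη hs => by
    obtain ⟨hi, h0⟩ := key η hη hs
    have := Complex.imCLM.integral_comp_comm hi
    rw [h0] at this
    simpa [-Complex.ofReal_add, -Complex.ofReal_mul, Complex.mul_im] using this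
  refine ⟨fun x => a x + b x * Complex.I, fun x => a' x + b' x * Complex.I, ?_, fun x => ?_,
    fun x => ?_⟩
  · filter_upwards [ha, hb] with x hxa hxb
    rw [hxa, hxb, Complex.re_add_im]
  · exact (had x).ofReal_comp.add ((hbd x).ofReal_comp.mul_const _)
  · refine ((had' x).ofReal_comp.add ((hbd' x).ofReal_comp.mul_const Complex.I)).congr_deriv ?_
    rw [Complex.real_smul]
    push_cast
    ring

/-! ### Multiplier estimates on the half line -/

/-- The behaviour of a confining potential `W` on the half line `[0, ∞)`, with derivative `W'`:
beyond some point `W ≤ C x^k` and `c x^(k-1) ≤ W'`. -/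
structure GrowsLikePower (W W' : ℝ → ℝ) (k : ℝ) : Prop where
  hasDerivAt : ∀ x, HasDerivAt W (W' x) x
  continuous_deriv : Continuous W'
  nonneg : ∀ x, 0 ≤ W x
  two_le : 2 ≤ k
  tail : ∃ R c C : ℝ, 1 ≤ R ∧ 0 < c ∧ 0 < C ∧
    ∀ x, R ≤ x → c * x ^ (k - 1) ≤ W' x ∧ W x ≤ C * x ^ k

theorem GrowsLikePower.continuous {W W' : ℝ → ℝ} {k : ℝ} (hW : GrowsLikePower W W' k) :
    Continuous W :=
  continuous_iff_continuousAt.2 fun x => (hW.hasDerivAt x).continuousAt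

/-- `u` is a classical solution of `-u'' + (W - E) u = f` with `u` and `f` square integrable
on `(0, ∞)`. -/
structure IsHalfLineSolution (W : ℝ → ℝ) (E : ℝ) (u u' f : ℝ → ℂ) : Prop where
  hasDerivAt : ∀ x, HasDerivAt u (u' x) x
  hasDerivAt_deriv : ∀ x, HasDerivAt u' ((W x - E) • u x - f x) x
  continuous_forcing : Continuous f
  sq_integrable : IntegrableOn (fun x => ‖u x‖ ^ 2) (Set.Ioi 0)
  sq_integrable_forcing : IntegrableOn (fun x => ‖f x‖ ^ 2) (Set.Ioi 0)

theorem exists_lt_of_integrableOn_Ioi {h : ℝ → ℝ} (hh : IntegrableOn h (Set.Ioi 0)) {ε : ℝ}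
    (hε : 0 < ε) (A : ℝ) : ∃ T, A ≤ T ∧ 0 ≤ T ∧ h T < ε := by
  by_contra! H
  have h1 : IntegrableOn (fun _ : ℝ => ε) (Set.Ioi (max A 0)) := by
    refine Integrable.mono' (hh.mono_set (Set.Ioi_subset_Ioi (le_max_right A 0)))
      aestronglyMeasurable_const ?_
    refine (ae_restrict_iff' measurableSet_Ioi).2 (ae_of_all _ fun x hx => ?_)
    rw [Real.norm_of_nonneg hε.le]
    exact H x ((le_max_left A 0).trans (le_of_lt hx)) ((le_max_right A 0).trans (le_of_lt hx))
  rw [integrableOn_const_iff] at h1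
  simp [hε.ne'] at h1

theorem integral_Ioi_le_of_frequently {h : ℝ → ℝ} (hh : IntegrableOn h (Set.Ioi 0)) {B : ℝ}
    (H : ∀ ε > 0, ∀ A, ∃ T, A ≤ T ∧ ∫ x in (0 : ℝ)..T, h x ≤ B + ε) :
    ∫ x in Set.Ioi 0, h x ≤ B := by
  refine le_of_forall_pos_le_add fun ε hε => ?_
  refine le_of_tendsto_of_frequently (intervalIntegral_tendsto_integral_Ioi 0 hh tendsto_id) ?_
  exact frequently_atTop.2 fun A => (H ε hε A).imp fun T hT => hT

theorem intervalIntegral_le_integral_Ioi {h : ℝ → ℝ} (hh : IntegrableOn h (Set.Ioi 0))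
    (h0 : ∀ x, 0 ≤ h x) {p q : ℝ} (hp : 0 ≤ p) (hpq : p ≤ q) :
    ∫ x in p..q, h x ≤ ∫ x in Set.Ioi 0, h x := by
  rw [intervalIntegral.integral_of_le hpq]
  exact setIntegral_mono_set hh (ae_of_all _ h0)
    (ae_of_all _ fun x hx => lt_of_le_of_lt hp hx.1)

theorem abs_real_inner_le_half (z w : ℂ) : |inner ℝ z w| ≤ (‖z‖ ^ 2 + ‖w‖ ^ 2) / 2 := by
  have := abs_real_inner_le_norm z w
  nlinarith [sq_nonneg (‖z‖ - ‖w‖)]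

namespace IsHalfLineSolution

variable {W : ℝ → ℝ} {E : ℝ} {u u' f : ℝ → ℂ}

theorem continuous (h : IsHalfLineSolution W E u u' f) : Continuous u :=
  continuous_iff_continuousAt.2 fun x => (h.hasDerivAt x).continuousAt

theorem continuous_deriv (h : IsHalfLineSolution W E u u' f) : Continuous u' :=
  continuous_iff_continuousAt.2 fun x => (h.hasDerivAt_deriv x).continuousAt

theorem hasDerivAt_normSq (h : IsHalfLineSolution W E u u' f) (x : ℝ) :
    HasDerivAt (fun x => ‖u x‖ ^ 2) (2 * inner ℝ (u x) (u' x)) x :=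
  (h.hasDerivAt x).norm_sq

theorem hasDerivAt_inner (h : IsHalfLineSolution W E u u' f) (x : ℝ) :
    HasDerivAt (fun x => inner ℝ (u x) (u' x))
      (‖u' x‖ ^ 2 + (W x - E) * ‖u x‖ ^ 2 - inner ℝ (u x) (f x)) x := by
  refine ((h.hasDerivAt x).inner ℝ (h.hasDerivAt_deriv x)).congr_deriv ?_
  rw [inner_sub_right, real_inner_smul_right, real_inner_self_eq_norm_sq,
    real_inner_self_eq_norm_sq]
  ring

theorem hasDerivAt_energy (h : IsHalfLineSolution W E u u' f) {W' : ℝ → ℝ} {x : ℝ}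
    (hW : HasDerivAt W (W' x) x) :
    HasDerivAt (fun x => ‖u' x‖ ^ 2 + (E - W x) * ‖u x‖ ^ 2)
      (-(2 * inner ℝ (u' x) (f x)) - W' x * ‖u x‖ ^ 2) x := by
  refine ((h.hasDerivAt_deriv x).norm_sq.add
    ((hW.const_sub E).mul (h.hasDerivAt_normSq x))).congr_deriv ?_
  rw [inner_sub_right, real_inner_smul_right, real_inner_comm (u x) (u' x)]
  ring

/-- A pointwise lower bound for a derivative, integrated. -/
theorem integral_bound (h : IsHalfLineSolution W E u u' f) {Φ Φ' : ℝ → ℝ} {p q α β : ℝ}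
    (hpq : p ≤ q) (hΦ : ∀ x, HasDerivAt Φ (Φ' x) x)
    (hle : ∀ x ∈ Set.Ioo p q, α * ‖u x‖ ^ 2 - β * ‖f x‖ ^ 2 ≤ Φ' x) :
    α * (∫ x in p..q, ‖u x‖ ^ 2) ≤ Φ q - Φ p + β * ∫ x in p..q, ‖f x‖ ^ 2 := by
  have hc := h.continuous
  have hf := h.continuous_forcing
  have c1 : Continuous fun x => α * ‖u x‖ ^ 2 := by fun_prop
  have c2 : Continuous fun x => β * ‖f x‖ ^ 2 := by fun_prop
  have := intervalIntegral.integral_le_sub_of_hasDeriv_right_of_le (g := Φ) (g' := Φ')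
    (φ := fun x => α * ‖u x‖ ^ 2 - β * ‖f x‖ ^ 2) hpq
    (fun x _ => (hΦ x).continuousAt.continuousWithinAt)
    (fun x _ => (hΦ x).hasDerivWithinAt) (c1.sub c2).integrableOn_Icc hle
  rw [intervalIntegral.integral_sub (c1.intervalIntegrable _ _) (c2.intervalIntegrable _ _),
    intervalIntegral.integral_const_mul, intervalIntegral.integral_const_mul] at this
  linarith

/-- A square integrable solution has finite energy: otherwise `(|u|²)' = 2 Re ū u'` would
eventually exceed a positive constant. -/
theorem integrableOn_energy (h : IsHalfLineSolution W E u u' f) (hW : Continuous W)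
    (hW0 : ∀ x, 0 ≤ W x) :
    IntegrableOn (fun x => ‖u' x‖ ^ 2 + W x * ‖u x‖ ^ 2) (Set.Ioi 0) := by
  have hc := h.continuous
  have hc' := h.continuous_deriv
  have hf := h.continuous_forcing
  have hρ : Continuous fun x => ‖u' x‖ ^ 2 + W x * ‖u x‖ ^ 2 := by fun_prop
  have hρ0 : ∀ x, 0 ≤ ‖u' x‖ ^ 2 + W x * ‖u x‖ ^ 2 := fun x => by
    have := hW0 x
    positivity
  by_contra hn
  set σ : ℝ → ℝ := fun x => (|E| + 1) * ‖u x‖ ^ 2 + ‖f x‖ ^ 2 with hσ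
  have hσc : Continuous σ := by fun_prop
  have hσi : IntegrableOn σ (Set.Ioi 0) :=
    (h.sq_integrable.const_mul _).add h.sq_integrable_forcing
  set K := ∫ x in Set.Ioi 0, σ x with hK
  set N : ℝ → ℝ := fun x => inner ℝ (u x) (u' x) with hN
  have hlow : ∀ T, 0 ≤ T →
      (∫ x in (0 : ℝ)..T, (‖u' x‖ ^ 2 + W x * ‖u x‖ ^ 2)) - K ≤ N T - N 0 := by
    intro T hT
    have h1 := intervalIntegral.integral_le_sub_of_hasDeriv_right_of_le (g := N)
      (φ := fun x => (‖u' x‖ ^ 2 + W x * ‖u x‖ ^ 2) - σ x) hT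
      (fun x _ => (h.hasDerivAt_inner x).continuousAt.continuousWithinAt)
      (fun x _ => (h.hasDerivAt_inner x).hasDerivWithinAt) (hρ.sub hσc).integrableOn_Icc
      (fun x _ => by
        have h2 := (abs_le.1 (abs_real_inner_le_half (u x) (f x))).2
        have h3 : E * ‖u x‖ ^ 2 ≤ |E| * ‖u x‖ ^ 2 :=
          mul_le_mul_of_nonneg_right (le_abs_self E) (sq_nonneg _)
        simp only [hσ]
        nlinarith [sq_nonneg ‖u x‖, sq_nonneg ‖f x‖])
    rw [intervalIntegral.integral_sub (hρ.intervalIntegrable _ _)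
      (hσc.intervalIntegrable _ _)] at h1
    have h2 := intervalIntegral_le_integral_Ioi hσi (fun x => by positivity) le_rfl hT
    linarith
  obtain ⟨T₀, hT₀, hbig⟩ : ∃ T₀, 0 ≤ T₀ ∧
      K + 1 - N 0 ≤ ∫ x in (0 : ℝ)..T₀, (‖u' x‖ ^ 2 + W x * ‖u x‖ ^ 2) := by
    by_contra! H
    refine hn (integrableOn_Ioi_of_intervalIntegral_norm_bounded (K + 1 - N 0) 0
      (fun i : ℝ => hρ.integrableOn_Ioc) tendsto_id ?_)
    filter_upwards [eventually_ge_atTop 0] with T hT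
    simp_rw [Real.norm_of_nonneg (hρ0 _)]
    exact (H T hT).le
  have hN1 : ∀ T, T₀ ≤ T → 1 ≤ N T := by
    intro T hT
    have h1 := hlow T (hT₀.trans hT)
    have h2 := intervalIntegral.integral_mono_interval (f := fun x => ‖u' x‖ ^ 2 + W x * ‖u x‖ ^ 2)
      (μ := volume) le_rfl hT₀ hT (ae_of_all _ hρ0) (hρ.intervalIntegrable _ _)
    linarith
  obtain ⟨T, hT, -, hlt⟩ := exists_lt_of_integrableOn_Ioi h.sq_integrable one_pos (T₀ + 1)
  have h3 := intervalIntegral.integral_le_sub_of_hasDeriv_right_of_le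
    (g := fun x => ‖u x‖ ^ 2) (φ := fun _ => (2 : ℝ)) (show T₀ ≤ T by linarith)
    (fun x _ => (h.hasDerivAt_normSq x).continuousAt.continuousWithinAt)
    (fun x _ => (h.hasDerivAt_normSq x).hasDerivWithinAt) continuous_const.integrableOn_Icc
    (fun x hx => by linarith [hN1 x hx.1.le])
  rw [intervalIntegral.integral_const, smul_eq_mul] at h3
  nlinarith [sq_nonneg ‖u T₀‖]

/-- Boundary terms at infinity vanish along a sequence. -/
theorem exists_small (h : IsHalfLineSolution W E u u' f) (hW : Continuous W)
    (hW0 : ∀ x, 0 ≤ W x) {ε : ℝ} (hε : 0 < ε) (A : ℝ) :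
    ∃ T, A ≤ T ∧ 0 ≤ T ∧ ‖u' T‖ ^ 2 + W T * ‖u T‖ ^ 2 + ‖u T‖ ^ 2 < ε :=
  exists_lt_of_integrableOn_Ioi ((h.integrableOn_energy hW hW0).add h.sq_integrable) hε A

/-- A priori bound for a bounded range of energies: Gronwall's inequality on a compact interval,
and positivity of `W - E` beyond it. -/
theorem integral_le_of_energy_le (h : IsHalfLineSolution W E u u' f) (hW : Continuous W)
    (hW0 : ∀ x, 0 ≤ W x) (h0 : u 0 = 0) (h0' : u' 0 = 0) {E₀ R M : ℝ} (hE : 0 ≤ E) (hE₀ : E ≤ E₀)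
    (hR : 0 ≤ R) (hM : ∀ x ∈ Set.Icc 0 R, W x ≤ M) (hRW : ∀ x, R ≤ x → E₀ + 1 ≤ W x) :
    ∫ x in Set.Ioi 0, ‖u x‖ ^ 2 ≤
      ((R + 1) * Real.exp ((M + E₀ + 2) * R) + 1) * ∫ x in Set.Ioi 0, ‖f x‖ ^ 2 := by
  set F := ∫ x in Set.Ioi 0, ‖f x‖ ^ 2 with hF
  have hF0 : 0 ≤ F := setIntegral_nonneg measurableSet_Ioi fun x _ => sq_nonneg _
  have hc := h.continuous
  have hf := h.continuous_forcing
  have hFle : ∀ p q, 0 ≤ p → p ≤ q → ∫ x in p..q, ‖f x‖ ^ 2 ≤ F := fun p q hp hpq =>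
    intervalIntegral_le_integral_Ioi h.sq_integrable_forcing (fun x => sq_nonneg _) hp hpq
  have hM0 : 0 ≤ M := (hW0 0).trans (hM 0 ⟨le_rfl, hR⟩)
  -- the rate in Gronwall's inequality for `|u|² + |u'|²`
  set K := M + E₀ + 2 with hK
  have hK0 : 0 ≤ K := by linarith
  have hy : ∀ x ∈ Set.Icc 0 R, ‖u x‖ ^ 2 + ‖u' x‖ ^ 2 ≤ Real.exp (K * R) * F := by
    intro x hx
    have hd : ∀ t, HasDerivAt (fun t => -(Real.exp (-K * t) * (‖u t‖ ^ 2 + ‖u' t‖ ^ 2)))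
        (-(Real.exp (-K * t) * (-K) * (‖u t‖ ^ 2 + ‖u' t‖ ^ 2) + Real.exp (-K * t) *
          (2 * inner ℝ (u t) (u' t) + 2 * inner ℝ (u' t) ((W t - E) • u t - f t)))) t := by
      intro t
      have he : HasDerivAt (fun t => Real.exp (-K * t)) (Real.exp (-K * t) * (-K)) t := by
        simpa using ((hasDerivAt_id t).const_mul (-K)).exp
      exact (he.mul ((h.hasDerivAt_normSq t).add (h.hasDerivAt_deriv t).norm_sq)).neg
    have := h.integral_bound (α := 0) (β := 1) hx.1 hd (by
      intro t ht
      have hW1 := hW0 t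
      have hW2 := hM t ⟨ht.1.le, ht.2.le.trans hx.2⟩
      have i1 := (abs_le.1 (abs_real_inner_le_half (u t) (u' t))).2
      have i2 := (abs_le.1 (abs_real_inner_le_half (u' t) (u t)))
      have i3 := (abs_le.1 (abs_real_inner_le_half (u' t) (f t))).1
      have hexp : Real.exp (-K * t) ≤ 1 := Real.exp_le_one_iff.2 (by nlinarith [ht.1])
      have hexp0 := Real.exp_pos (-K * t)
      rw [inner_sub_right, real_inner_smul_right]
      set y := ‖u t‖ ^ 2 + ‖u' t‖ ^ 2 with hy
      have hy0 : 0 ≤ y := by positivity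
      have i4 : (W t - E) * inner ℝ (u' t) (u t) ≤ (M + E₀) * (y / 2) := by
        refine (le_abs_self _).trans ?_
        rw [abs_mul]
        refine mul_le_mul (abs_le.2 ⟨by linarith, by linarith⟩) ?_ (abs_nonneg _) (by linarith)
        refine (abs_real_inner_le_half _ _).trans (by rw [hy]; linarith)
      have i5 : 2 * inner ℝ (u t) (u' t) + 2 * ((W t - E) * inner ℝ (u' t) (u t) -
          inner ℝ (u' t) (f t)) - K * y ≤ ‖f t‖ ^ 2 := by
        have : K * y = (M + E₀) * y + 2 * y := by rw [hK]; ring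
        nlinarith [sq_nonneg ‖u t‖]
      have i6 := mul_le_mul_of_nonneg_left i5 hexp0.le
      have i7 : Real.exp (-K * t) * ‖f t‖ ^ 2 ≤ 1 * ‖f t‖ ^ 2 :=
        mul_le_mul_of_nonneg_right hexp (sq_nonneg _)
      nlinarith)
    simp only [h0, h0', norm_zero] at this
    have h1 : Real.exp (-K * x) * (‖u x‖ ^ 2 + ‖u' x‖ ^ 2) ≤ F := by
      have := hFle 0 x le_rfl hx.1
      norm_num at *
      linarith
    have h2 : ‖u x‖ ^ 2 + ‖u' x‖ ^ 2 ≤ Real.exp (K * x) * F := by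
      have := mul_le_mul_of_nonneg_left h1 (Real.exp_pos (K * x)).le
      rwa [← mul_assoc, ← Real.exp_add, show K * x + -K * x = 0 by ring, Real.exp_zero,
        one_mul] at this
    refine h2.trans (mul_le_mul_of_nonneg_right (Real.exp_le_exp.2 ?_) hF0)
    exact mul_le_mul_of_nonneg_left hx.2 hK0
  set G := Real.exp (K * R) with hG
  have hcore : ∫ x in (0 : ℝ)..R, ‖u x‖ ^ 2 ≤ R * G * F := by
    have hcu : Continuous fun x => ‖u x‖ ^ 2 := by fun_prop
    have := intervalIntegral.integral_mono_on (μ := volume) hR (hcu.intervalIntegrable _ _)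
      (continuous_const.intervalIntegrable _ _ : IntervalIntegrable (fun _ => G * F) volume 0 R)
      fun x hx => (by linarith [hy x hx, sq_nonneg ‖u' x‖] : ‖u x‖ ^ 2 ≤ G * F)
    rw [intervalIntegral.integral_const, smul_eq_mul] at this
    linarith
  refine integral_Ioi_le_of_frequently h.sq_integrable fun ε hε A => ?_
  obtain ⟨T, hT, -, hs⟩ := h.exists_small hW hW0 hε (max A R)
  have hRT : R ≤ T := (le_max_right _ _).trans hT
  refine ⟨T, (le_max_left _ _).trans hT, ?_⟩
  have htail := h.integral_bound (α := 1 / 2) (β := 1 / 2) hRT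
    (fun x => h.hasDerivAt_inner x) (fun x hx => by
      have h1 := hRW x hx.1.le
      have h2 := (abs_le.1 (abs_real_inner_le_half (u x) (f x))).2
      nlinarith [sq_nonneg ‖u x‖, sq_nonneg ‖u' x‖])
  have b1 := (abs_le.1 (abs_real_inner_le_half (u T) (u' T))).2
  have b2 := (abs_le.1 (abs_real_inner_le_half (u R) (u' R))).1
  have b3 := hy R ⟨hR, le_rfl⟩
  have b4 := hFle R T hR hRT
  have b5 : 0 ≤ W T * ‖u T‖ ^ 2 := mul_nonneg (hW0 T) (sq_nonneg _)
  have hcu : Continuous fun x => ‖u x‖ ^ 2 := by fun_prop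
  rw [← intervalIntegral.integral_add_adjacent_intervals (hcu.intervalIntegrable 0 R)
    (hcu.intervalIntegrable R T)]
  nlinarith

/-- A priori bound for one large energy `E`. The multiplier `a u'` with the weight
`a(x) = -(2 A - min(x, A))` produces `a' (E - W) - a W'` in front of `|u|²`, which is at least
`κ E`: inside `[0, A]` because `W` is much smaller than `E`, beyond `A` because `W'` is large. -/
theorem integral_le_of_multiplier (h : IsHalfLineSolution W E u u' f) {W' : ℝ → ℝ}
    (hWd : ∀ x, HasDerivAt W (W' x) x) (hW0 : ∀ x, 0 ≤ W x) (h0 : u 0 = 0) (h0' : u' 0 = 0)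
    {A κ L : ℝ} (hE : 1 ≤ E) (hA : 1 ≤ A) (hκ : 0 < κ) (hκ1 : κ ≤ 1) (hAL : A ^ 2 ≤ L * E)
    (hin : ∀ x, 0 ≤ x → x ≤ A → κ * E ≤ (E - W x) + (2 * A - x) * W' x)
    (hout : ∀ x, A ≤ x → κ * E ≤ A * W' x) :
    ∫ x in Set.Ioi 0, ‖u x‖ ^ 2 ≤ (32 * L / κ ^ 2 + 1) * ∫ x in Set.Ioi 0, ‖f x‖ ^ 2 := by
  have hW : Continuous W := continuous_iff_continuousAt.2 fun x => (hWd x).continuousAt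
  set F := ∫ x in Set.Ioi 0, ‖f x‖ ^ 2 with hF
  have hc := h.continuous
  have hFle : ∀ p q, 0 ≤ p → p ≤ q → ∫ x in p..q, ‖f x‖ ^ 2 ≤ F := fun p q hp hpq =>
    intervalIntegral_le_integral_Ioi h.sq_integrable_forcing (fun x => sq_nonneg _) hp hpq
  have hE0 : 0 < E := by linarith
  -- adding `θ u` to the multiplier `a u'` produces the term `θ |u'|²` that absorbs `2 a f ū'`;
  -- its cost `θ E |u|²` is half of the gain `κ E |u|²`
  set θ := κ / 2 with hθ
  set α := κ / 4 * E with hα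
  set β := (8 * L / κ + κ / 4) * E with hβ
  have hL : 0 ≤ L := by
    by_contra! hL
    nlinarith
  have hβ0 : 0 ≤ β := by positivity
  -- completing squares in the derivative of the multiplier functional
  have alg : ∀ (a a' : ℝ) (x : ℝ), |a| ≤ 2 * A → 0 ≤ a' → κ * E ≤ a' * (E - W x) - a * W' x →
      α * ‖u x‖ ^ 2 - β * ‖f x‖ ^ 2 ≤
        a' * (‖u' x‖ ^ 2 + (E - W x) * ‖u x‖ ^ 2) +
        a * (-(2 * inner ℝ (u' x) (f x)) - W' x * ‖u x‖ ^ 2) +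
        θ * (‖u' x‖ ^ 2 + (W x - E) * ‖u x‖ ^ 2 - inner ℝ (u x) (f x)) := by
    intro a a' x ha ha' hq
    have e1 : κ * E * ‖u x‖ ^ 2 ≤ (a' * (E - W x) - a * W' x) * ‖u x‖ ^ 2 :=
      mul_le_mul_of_nonneg_right hq (sq_nonneg _)
    have e2 : a * inner ℝ (u' x) (f x) ≤ 2 * A * (‖u' x‖ * ‖f x‖) := by
      refine (le_abs_self _).trans ?_
      rw [abs_mul]
      exact mul_le_mul ha (abs_real_inner_le_norm _ _) (abs_nonneg _) (by linarith)
    have e3 : 4 * A * (‖u' x‖ * ‖f x‖) ≤ θ * ‖u' x‖ ^ 2 + 8 * L / κ * E * ‖f x‖ ^ 2 := by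
      have s1 : 0 ≤ (κ * ‖u' x‖ - 4 * A * ‖f x‖) ^ 2 := sq_nonneg _
      have s2 : A ^ 2 * ‖f x‖ ^ 2 ≤ L * E * ‖f x‖ ^ 2 :=
        mul_le_mul_of_nonneg_right hAL (sq_nonneg _)
      have s3 : 8 * L / κ * E * ‖f x‖ ^ 2 = (8 * (L * E * ‖f x‖ ^ 2)) / κ := by ring
      rw [s3, hθ, ← sub_le_iff_le_add', le_div_iff₀ hκ]
      nlinarith
    have e4 : inner ℝ (u x) (f x) ≤ (‖u x‖ ^ 2 + ‖f x‖ ^ 2) / 2 :=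
      (abs_le.1 (abs_real_inner_le_half _ _)).2
    have e5 : θ * inner ℝ (u x) (f x) ≤ κ / 4 * E * (‖u x‖ ^ 2 + ‖f x‖ ^ 2) := by
      have s1 : θ * inner ℝ (u x) (f x) ≤ κ / 4 * (‖u x‖ ^ 2 + ‖f x‖ ^ 2) := by
        rw [hθ]; nlinarith
      refine s1.trans ?_
      have : 0 ≤ κ / 4 * (‖u x‖ ^ 2 + ‖f x‖ ^ 2) := by positivity
      nlinarith
    have e6 : 0 ≤ a' * ‖u' x‖ ^ 2 := mul_nonneg ha' (sq_nonneg _)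
    have e7 : 0 ≤ θ * (W x * ‖u x‖ ^ 2) :=
      mul_nonneg (by positivity) (mul_nonneg (hW0 x) (sq_nonneg _))
    simp only [hα, hβ, hθ] at *
    nlinarith
  have hd1 : ∀ x, HasDerivAt (fun x => (x - 2 * A) * (‖u' x‖ ^ 2 + (E - W x) * ‖u x‖ ^ 2) +
      θ * inner ℝ (u x) (u' x)) (1 * (‖u' x‖ ^ 2 + (E - W x) * ‖u x‖ ^ 2) +
        (x - 2 * A) * (-(2 * inner ℝ (u' x) (f x)) - W' x * ‖u x‖ ^ 2) +
        θ * (‖u' x‖ ^ 2 + (W x - E) * ‖u x‖ ^ 2 - inner ℝ (u x) (f x))) x := fun x =>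
    (((hasDerivAt_id x).sub_const (2 * A)).mul (h.hasDerivAt_energy (hWd x))).add
      ((h.hasDerivAt_inner x).const_mul θ)
  have hd2 : ∀ x, HasDerivAt (fun x => (-A) * (‖u' x‖ ^ 2 + (E - W x) * ‖u x‖ ^ 2) +
      θ * inner ℝ (u x) (u' x)) (0 * (‖u' x‖ ^ 2 + (E - W x) * ‖u x‖ ^ 2) +
        (-A) * (-(2 * inner ℝ (u' x) (f x)) - W' x * ‖u x‖ ^ 2) +
        θ * (‖u' x‖ ^ 2 + (W x - E) * ‖u x‖ ^ 2 - inner ℝ (u x) (f x))) x := fun x =>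
    ((hasDerivAt_const x (-A)).mul (h.hasDerivAt_energy (hWd x))).add
      ((h.hasDerivAt_inner x).const_mul θ)
  have hcu : Continuous fun x => ‖u x‖ ^ 2 := by fun_prop
  have hcf : Continuous fun x => ‖f x‖ ^ 2 := by
    have := h.continuous_forcing
    fun_prop
  have main : α * ∫ x in Set.Ioi 0, ‖u x‖ ^ 2 ≤ β * F := by
    rw [← integral_const_mul]
    refine integral_Ioi_le_of_frequently (h.sq_integrable.const_mul α) fun ε hε B => ?_
    obtain ⟨T, hT, hT0, hs⟩ := h.exists_small hW hW0 (div_pos hε (show 0 < A + 1 by linarith))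
      (max B A)
    have hAT : A ≤ T := (le_max_right _ _).trans hT
    refine ⟨T, (le_max_left _ _).trans hT, ?_⟩
    have i1 := h.integral_bound (by linarith : (0 : ℝ) ≤ A) hd1 fun x hx =>
      alg (x - 2 * A) 1 x (abs_le.2 ⟨by linarith [hx.1], by linarith [hx.2]⟩) zero_le_one
        (by linarith [hin x hx.1.le hx.2.le])
    have i2 := h.integral_bound hAT hd2 fun x hx =>
      alg (-A) 0 x (abs_le.2 ⟨by linarith, by linarith⟩) le_rfl (by linarith [hout x hx.1.le])
    simp only [h0, h0', norm_zero, inner_zero_left] at i1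
    have i3 := mul_le_mul_of_nonneg_left (hFle 0 T le_rfl hT0) hβ0
    rw [← intervalIntegral.integral_add_adjacent_intervals (hcf.intervalIntegrable 0 A)
      (hcf.intervalIntegrable A T)] at i3
    rw [intervalIntegral.integral_const_mul,
      ← intervalIntegral.integral_add_adjacent_intervals (hcu.intervalIntegrable 0 A)
      (hcu.intervalIntegrable A T)]
    rw [lt_div_iff₀ (by linarith)] at hs
    have b1 := (abs_le.1 (abs_real_inner_le_half (u T) (u' T))).2
    have b2 : 0 ≤ W T * ‖u T‖ ^ 2 := mul_nonneg (hW0 T) (sq_nonneg _)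
    have b3 : θ * inner ℝ (u T) (u' T) ≤ 1 * ((‖u T‖ ^ 2 + ‖u' T‖ ^ 2) / 2) := by
      have : 0 ≤ (‖u T‖ ^ 2 + ‖u' T‖ ^ 2) / 2 := by positivity
      nlinarith
    have b4 : 0 ≤ A * (E * ‖u T‖ ^ 2) := by positivity
    have b5 : 0 ≤ A * ‖u' T‖ ^ 2 := by positivity
    have b6 : 0 ≤ A * ‖u T‖ ^ 2 := by positivity
    nlinarith [sq_nonneg ‖u T‖, sq_nonneg ‖u' T‖]
  have hα0 : 0 < α := by positivity
  have : β * F = α * ((32 * L / κ ^ 2 + 1) * F) := by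
    rw [hα, hβ]; field_simp; ring
  rw [this] at main
  exact le_of_mul_le_mul_left main hα0

end IsHalfLineSolution

/-! ### The uniform a priori bound and the growth of the potential -/

/-- The a priori bound, uniform in the energy `E ≥ 0`: a solution of `-u'' + (W - E) u = f` on the
half line with zero initial data is controlled in `L²` by `f`. The hypothesis `2 ≤ k` enters through
`A² ≤ A^k`, where `A^k` is comparable to `E`. -/
theorem GrowsLikePower.exists_apriori_bound {W W' : ℝ → ℝ} {k : ℝ} (hW : GrowsLikePower W W' k) :
    ∃ K : ℝ, 0 < K ∧ ∀ (E : ℝ) (u u' f : ℝ → ℂ), 0 ≤ E → IsHalfLineSolution W E u u' f →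
      u 0 = 0 → u' 0 = 0 →
      ∫ x in Set.Ioi 0, ‖u x‖ ^ 2 ≤ K * ∫ x in Set.Ioi 0, ‖f x‖ ^ 2 := by
  obtain ⟨R, c, C, hR, hc, hC, htail⟩ := hW.tail
  have hk := hW.two_le
  obtain ⟨M, hM⟩ := (isCompact_Icc (a := (0 : ℝ)) (b := R)).exists_bound_of_continuousOn
    hW.continuous.continuousOn
  obtain ⟨M', hM'⟩ := (isCompact_Icc (a := (0 : ℝ)) (b := R)).exists_bound_of_continuousOn
    hW.continuous_deriv.continuousOn
  have hMW : ∀ x, 0 ≤ x → x ≤ R → W x ≤ M := fun x h1 h2 =>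
    (le_abs_self _).trans (hM x ⟨h1, h2⟩)
  have hMW' : ∀ x, 0 ≤ x → x ≤ R → -M' ≤ W' x := fun x h1 h2 =>
    (abs_le.1 (hM' x ⟨h1, h2⟩)).1
  have hM0 : 0 ≤ M := (norm_nonneg _).trans (hM 0 ⟨le_rfl, by linarith⟩)
  have hM0' : 0 ≤ M' := (norm_nonneg _).trans (hM' 0 ⟨le_rfl, by linarith⟩)
  -- the threshold between low and high energies
  set A₀ := max R ((M + 2 * M') / C) with hA₀
  have hA₀R : R ≤ A₀ := le_max_left _ _
  set E₀ := max 1 (2 * C * A₀ ^ k) with hE₀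
  have hE₀1 : 1 ≤ E₀ := le_max_left _ _
  set R₀ := R + (E₀ + 1) / c with hR₀
  have hRR₀ : R ≤ R₀ := by
    have : 0 ≤ (E₀ + 1) / c := by positivity
    linarith
  have hderiv : ∀ x, R ≤ x → c ≤ W' x := fun x hx => by
    have h1 : (1 : ℝ) ≤ x ^ (k - 1) := Real.one_le_rpow (by linarith) (by linarith)
    nlinarith [(htail x hx).1]
  have hlarge : ∀ x, R₀ ≤ x → E₀ + 1 ≤ W x := by
    intro x hx
    have h1 := intervalIntegral.integral_le_sub_of_hasDeriv_right_of_le (g := W) (g' := W')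
      (φ := fun _ => c) (hRR₀.trans hx) hW.continuous.continuousOn
      (fun y _ => (hW.hasDerivAt y).hasDerivWithinAt) continuous_const.integrableOn_Icc
      (fun y hy => hderiv y hy.1.le)
    rw [intervalIntegral.integral_const, smul_eq_mul] at h1
    have h2 : (E₀ + 1) / c * c ≤ (x - R) * c :=
      mul_le_mul_of_nonneg_right (by linarith) hc.le
    rw [div_mul_cancel₀ _ hc.ne'] at h2
    linarith [hW.nonneg R]
  obtain ⟨M₀, hM₀⟩ := (isCompact_Icc (a := (0 : ℝ)) (b := R₀)).exists_bound_of_continuousOn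
    hW.continuous.continuousOn
  set κ := min (1 / 2) (c / (2 * C)) with hκ
  have hκ0 : 0 < κ := lt_min (by norm_num) (by positivity)
  have hκ1 : κ ≤ 1 / 2 := min_le_left _ _
  set L := 1 / (2 * C) with hL
  set K₁ := (R₀ + 1) * Real.exp ((M₀ + E₀ + 2) * R₀) + 1 with hK₁
  set K₂ := 32 * L / κ ^ 2 + 1 with hK₂
  refine ⟨max K₁ K₂, lt_max_of_lt_right (by positivity), fun E u u' f hE h h0 h0' => ?_⟩
  have hF0 : 0 ≤ ∫ x in Set.Ioi 0, ‖f x‖ ^ 2 :=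
    setIntegral_nonneg measurableSet_Ioi fun x _ => sq_nonneg _
  rcases le_total E E₀ with hEE | hEE
  · refine (h.integral_le_of_energy_le hW.continuous hW.nonneg h0 h0' hE hEE
      (by linarith : (0 : ℝ) ≤ R₀) (fun x hx => (le_abs_self _).trans (hM₀ x hx)) hlarge).trans ?_
    exact mul_le_mul_of_nonneg_right (le_max_left _ _) hF0
  · -- chosen so that `W ≤ C A^k = E / 2` on `[R, A]`
    set A := (E / (2 * C)) ^ (1 / k) with hA
    have hE1 : 1 ≤ E := hE₀1.trans hEE
    have hAk : A ^ k = E / (2 * C) := by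
      rw [hA, ← Real.rpow_mul (by positivity), one_div_mul_cancel (by linarith), Real.rpow_one]
    have hA0 : 0 ≤ A := by positivity
    have hAA₀ : A₀ ≤ A := by
      refine (Real.rpow_le_rpow_iff (by linarith) hA0 (by linarith : 0 < k)).1 ?_
      rw [hAk, le_div_iff₀ (by positivity)]
      linarith [(le_max_right 1 (2 * C * A₀ ^ k)).trans hEE]
    have hRA : R ≤ A := hA₀R.trans hAA₀
    have hA1 : 1 ≤ A := hR.trans hRA
    have hCA : C * A ^ k = E / 2 := by rw [hAk]; field_simp
    have hA2 : A ^ 2 ≤ A ^ k := by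
      rw [← Real.rpow_natCast]
      exact Real.rpow_le_rpow_of_exponent_le hA1 (by exact_mod_cast hk)
    have hκE : κ * E ≤ E / 2 := by nlinarith
    refine (h.integral_le_of_multiplier hW.hasDerivAt hW.nonneg h0 h0' hE1 hA1 hκ0 (by linarith)
      (L := L) (by rw [hL]; linarith [hAk, show 1 / (2 * C) * E = E / (2 * C) by ring])
      (fun x hx hxA => ?_) (fun x hx => ?_)).trans
      (mul_le_mul_of_nonneg_right (le_max_right _ _) hF0)
    · rcases le_total x R with hxR | hxR
      · have h1 : M + 2 * M' ≤ C * A := by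
          have := (le_max_right R ((M + 2 * M') / C)).trans hAA₀
          rw [div_le_iff₀ hC] at this
          linarith
        have h2 : (M + 2 * M') * A ≤ C * A * A := mul_le_mul_of_nonneg_right h1 hA0
        have h3 : C * A ^ 2 ≤ E / 2 := by
          rw [← hCA]
          exact mul_le_mul_of_nonneg_left hA2 hC.le
        have h4 : (2 * A - x) * (-M') ≤ (2 * A - x) * W' x :=
          mul_le_mul_of_nonneg_left (hMW' x hx hxR) (by linarith)
        have h5 := hMW x hx hxR
        nlinarith [mul_nonneg hx hM0', mul_nonneg hM0 (sub_nonneg.2 hA1)]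
      · have h1 : W x ≤ E / 2 := by
          rw [← hCA]
          exact (htail x hxR).2.trans (mul_le_mul_of_nonneg_left
            (Real.rpow_le_rpow hx hxA (by linarith)) hC.le)
        have h2 : 0 ≤ (2 * A - x) * W' x :=
          mul_nonneg (by linarith) (hc.le.trans (hderiv x hxR))
        linarith
    · have h1 : A ^ (k - 1) ≤ x ^ (k - 1) := Real.rpow_le_rpow hA0 hx (by linarith)
      have h2 : A * (c * A ^ (k - 1)) = c * A ^ k := by
        rw [Real.rpow_sub_one (by linarith)]
        field_simp
      have h3 : A * (c * A ^ (k - 1)) ≤ A * W' x :=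
        mul_le_mul_of_nonneg_left ((mul_le_mul_of_nonneg_left h1 hc.le).trans
          (htail x (hRA.trans hx)).1) hA0
      have h4 : κ * E ≤ c / (2 * C) * E := mul_le_mul_of_nonneg_right (min_le_right _ _) hE
      have h5 : c * A ^ k = c / (2 * C) * E := by rw [hAk]; ring
      linarith

/-- A symbol-type bound on `W''` upgrades the asymptotics `W ∼ c x^k` to the lower bound
`(c/2) x^(k-1) ≤ W'`. The difference quotient of `W` over `[x, (1 + ε) x]` is at least
`c x^(k-1)` by the asymptotics, and differs from `W' x` by `O(ε x^(k-1))`. -/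
theorem growsLikePower_of_tendsto {W W' W'' : ℝ → ℝ} {k c D : ℝ} (hk : 2 ≤ k) (hc : 0 < c)
    (hW : ∀ x, HasDerivAt W (W' x) x) (hW' : ∀ x, HasDerivAt W' (W'' x) x)
    (h0 : ∀ x, 0 ≤ W x) (hD : ∀ x, |W'' x| ≤ D * bracket x ^ (k - 2))
    (hlim : Tendsto (fun x => W x / bracket x ^ k) atTop (𝓝 c)) :
    GrowsLikePower W W' k := by
  have hbr : ∀ x : ℝ, 0 < bracket x := fun x => Real.sqrt_pos.2 (by positivity)
  have hlim1 : Tendsto (fun x : ℝ => bracket x / x) atTop (𝓝 1) := by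
    have h1 : Tendsto (fun x : ℝ => Real.sqrt ((x⁻¹) ^ 2 + 1)) atTop (𝓝 (Real.sqrt (0 ^ 2 + 1))) :=
      ((tendsto_inv_atTop_zero.pow 2).add_const 1).sqrt
    rw [show Real.sqrt (0 ^ 2 + 1) = 1 by norm_num] at h1
    refine h1.congr' ?_
    filter_upwards [eventually_gt_atTop 0] with x hx
    rw [bracket, ← Real.sqrt_sq hx.le, ← Real.sqrt_div (by positivity), Real.sqrt_sq hx.le]
    congr 1
    field_simp
  have hlimk : Tendsto (fun x => W x / x ^ k) atTop (𝓝 c) := by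
    have h1 := hlim.mul (hlim1.rpow_const (p := k) (Or.inl one_ne_zero))
    rw [Real.one_rpow, mul_one] at h1
    refine h1.congr' ?_
    filter_upwards [eventually_gt_atTop 0] with x hx
    rw [Real.div_rpow (hbr x).le hx.le]
    have := (Real.rpow_pos_of_pos (hbr x) k).ne'
    field_simp
  have hD0 : 0 ≤ D := by
    have := (abs_nonneg _).trans (hD 0)
    by_contra! h
    nlinarith [Real.rpow_pos_of_pos (hbr 0) (k - 2)]
  set D' := D * 4 ^ (k - 2) with hD'
  have hD'0 : 0 ≤ D' := by positivity
  set ε := min 1 (c / (2 * (D' + 1))) with hε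
  have hε0 : 0 < ε := lt_min one_pos (by positivity)
  have hε1 : ε ≤ 1 := min_le_left _ _
  have hεD : D' * ε ≤ c / 2 := by
    have h1 : ε ≤ c / (2 * (D' + 1)) := min_le_right _ _
    rw [le_div_iff₀ (by positivity)] at h1
    nlinarith
  -- the asymptotics along `x ↦ (1 + ε) x`
  have hlimε : Tendsto (fun x => W ((1 + ε) * x) / x ^ k) atTop (𝓝 (c * (1 + ε) ^ k)) := by
    have h1 : Tendsto (fun x : ℝ => (1 + ε) * x) atTop atTop :=
      tendsto_id.const_mul_atTop (by linarith)
    have h2 := (hlimk.comp h1).mul_const ((1 + ε) ^ k)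
    refine h2.congr' ?_
    filter_upwards [eventually_gt_atTop 0] with x hx
    have h3 : (0 : ℝ) < (1 + ε) ^ k := by positivity
    have h4 : (0 : ℝ) < x ^ k := by positivity
    simp only [Function.comp]
    rw [Real.mul_rpow (by linarith) hx.le]
    field_simp
  have hgap : c * ε < c * (1 + ε) ^ k - c := by
    have := one_add_mul_self_le_rpow_one_add (s := ε) (by linarith) (p := k) (by linarith)
    have h2 : 2 * ε ≤ k * ε := mul_le_mul_of_nonneg_right hk hε0.le
    nlinarith
  have hev := (hlimε.sub hlimk).eventually_const_lt hgap
  have hev2 := hlimk.eventually_le_const (show c < c + 1 by linarith)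
  obtain ⟨R, hR⟩ := eventually_atTop.1 (hev.and hev2)
  refine ⟨hW, continuous_iff_continuousAt.2 fun x => (hW' x).continuousAt, h0, hk,
    max R 1, c / 2, c + 1, le_max_right _ _, by positivity, by linarith, fun x hx => ?_⟩
  obtain ⟨e1, e2⟩ := hR x ((le_max_left _ _).trans hx)
  have hx1 : 1 ≤ x := (le_max_right _ _).trans hx
  have hx0 : 0 < x := by linarith
  have hxk : 0 < x ^ k := by positivity
  refine ⟨?_, by rwa [div_le_iff₀ hxk] at e2⟩
  rw [← sub_div, lt_div_iff₀ hxk] at e1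
  have hxx : x < (1 + ε) * x := by nlinarith
  obtain ⟨ξ, hξ, eξ⟩ := exists_hasDerivAt_eq_slope W W' hxx
    (continuous_iff_continuousAt.2 fun y => (hW y).continuousAt).continuousOn fun y _ => hW y
  obtain ⟨ζ, hζ, eζ⟩ := exists_hasDerivAt_eq_slope W' W'' hξ.1
    (continuous_iff_continuousAt.2 fun y => (hW' y).continuousAt).continuousOn fun y _ => hW' y
  have hεx : 0 < ε * x := by positivity
  rw [show (1 + ε) * x - x = ε * x by ring, eq_div_iff hεx.ne'] at eξ
  rw [eq_div_iff (by linarith [hξ.1])] at eζ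
  have hζ2 : bracket ζ ≤ 4 * x := by
    have h1 : ζ ≤ 2 * x := by nlinarith [hζ.2, hξ.2]
    refine Real.sqrt_le_iff.2 ⟨by linarith, ?_⟩
    nlinarith [hζ.1]
  have hW''ζ : W'' ζ ≤ D' * x ^ (k - 2) := by
    refine (le_abs_self _).trans ((hD ζ).trans ?_)
    rw [hD', mul_assoc, ← Real.mul_rpow (by norm_num) hx0.le]
    exact mul_le_mul_of_nonneg_left (Real.rpow_le_rpow (hbr ζ).le hζ2 (by linarith)) hD0
  have hp1 : x ^ (k - 2) * x = x ^ (k - 1) := by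
    rw [← Real.rpow_add_one hx0.ne']; congr 1; ring
  have hp2 : x ^ (k - 1) * x = x ^ k := by
    rw [← Real.rpow_add_one hx0.ne']; congr 1; ring
  have hp1' : 0 < x ^ (k - 1) := by positivity
  have h1 : c * x ^ (k - 1) ≤ W' ξ := by
    refine le_of_mul_le_mul_right ?_ hεx
    rw [eξ, show c * x ^ (k - 1) * (ε * x) = c * ε * (x ^ (k - 1) * x) by ring, hp2]
    exact e1.le
  have h2 : W' ξ - W' x ≤ D' * ε * x ^ (k - 1) := by
    rw [← eζ, ← hp1, show D' * ε * (x ^ (k - 2) * x) = D' * x ^ (k - 2) * (ε * x) by ring]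
    refine mul_le_mul hW''ζ (by linarith [hξ.2]) (by linarith [hξ.1]) (by positivity)
  have h3 : D' * ε * x ^ (k - 1) ≤ c / 2 * x ^ (k - 1) :=
    mul_le_mul_of_nonneg_right hεD hp1'.le
  linarith

theorem IsConfining.hasDerivAt {V : ℝ → ℝ} {k : ℝ} (hV : IsConfining V k) (x : ℝ) :
    HasDerivAt V (deriv V x) x ∧ HasDerivAt (deriv V) (deriv (deriv V) x) x := by
  obtain ⟨h1, h2⟩ := contDiff_infty_iff_deriv.1 hV.smooth
  exact ⟨(h1 x).hasDerivAt, ((contDiff_infty_iff_deriv.1 h2).1 x).hasDerivAt⟩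

theorem bracket_neg (x : ℝ) : bracket (-x) = bracket x := by simp [bracket]

theorem IsConfining.abs_deriv_deriv_le {V : ℝ → ℝ} {k : ℝ} (hV : IsConfining V k) :
    ∃ D : ℝ, ∀ x, |deriv (deriv V) x| ≤ D * bracket x ^ (k - 2) := by
  obtain ⟨D, -, hD⟩ := hV.symbol 2
  refine ⟨D, fun x => ?_⟩
  have := hD x
  rwa [show iteratedDeriv 2 V = deriv (deriv V) by
    rw [iteratedDeriv_succ, iteratedDeriv_one]] at this

theorem IsConfining.growsLikePower {V : ℝ → ℝ} {k : ℝ} (hV : IsConfining V k)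
    (h : IsAsymptoticToPower V k) : GrowsLikePower V (deriv V) k := by
  obtain ⟨c, hc, hlim⟩ := h
  obtain ⟨D, hD⟩ := hV.abs_deriv_deriv_le
  exact growsLikePower_of_tendsto hV.two_le hc (fun x => (hV.hasDerivAt x).1)
    (fun x => (hV.hasDerivAt x).2) hV.nonneg hD (hlim.mono_left atTop_le_cocompact)

theorem IsConfining.growsLikePower_comp_neg {V : ℝ → ℝ} {k : ℝ} (hV : IsConfining V k)
    (h : IsAsymptoticToPower V k) :
    GrowsLikePower (fun x => V (-x)) (fun x => -deriv V (-x)) k := by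
  obtain ⟨c, hc, hlim⟩ := h
  obtain ⟨D, hD⟩ := hV.abs_deriv_deriv_le
  refine growsLikePower_of_tendsto (W'' := fun x => deriv (deriv V) (-x)) hV.two_le hc
    (fun x => ?_) (fun x => ?_) (fun x => hV.nonneg _)
    (fun x => by rw [← bracket_neg]; exact hD (-x)) ?_
  · simpa [Function.comp_def] using (hV.hasDerivAt (-x)).1.comp x (hasDerivAt_neg x)
  · simpa [Function.comp_def] using ((hV.hasDerivAt (-x)).2.comp x (hasDerivAt_neg x)).fun_neg
  · refine ((hlim.mono_left atBot_le_cocompact).comp tendsto_neg_atTop_atBot).congr fun x => ?_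
    simp [bracket_neg]

/-! ### Positivity and separation of the eigenvalues -/

/-- Reflection of a solution on the negative half line. -/
theorem isHalfLineSolution_comp_neg {V : ℝ → ℝ} {E : ℝ} {u u' f : ℝ → ℂ}
    (hu : ∀ x, HasDerivAt u (u' x) x)
    (hu' : ∀ x, HasDerivAt u' ((V x - E) • u x - f x) x) (hf : Continuous f)
    (hsq : Integrable fun x => ‖u x‖ ^ 2) (hsqf : Integrable fun x => ‖f x‖ ^ 2) :
    IsHalfLineSolution (fun x => V (-x)) E (fun x => u (-x)) (fun x => -u' (-x))
      (fun x => f (-x)) where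
  hasDerivAt x := by
    simpa [Function.comp_def] using (hu (-x)).scomp x (hasDerivAt_neg x)
  hasDerivAt_deriv x := by
    have := ((hu' (-x)).scomp x (hasDerivAt_neg x)).fun_neg
    simpa [Function.comp_def] using this
  continuous_forcing := hf.comp continuous_neg
  sq_integrable := hsq.comp_neg.integrableOn
  sq_integrable_forcing := hsqf.comp_neg.integrableOn

theorem integral_Ioi_add_comp_neg {h : ℝ → ℝ} (hh : Integrable h) :
    (∫ x in Set.Ioi 0, h x) + ∫ x in Set.Ioi 0, h (-x) = ∫ x, h x := by
  rw [integral_comp_neg_Ioi, neg_zero, add_comm]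
  exact intervalIntegral.integral_Iic_add_Ioi hh.integrableOn hh.integrableOn

/-- For `W ≥ 0` the function `|u|²` is convex, so if it increased somewhere it could not be
integrable. -/
theorem IsHalfLineSolution.inner_nonpos {W : ℝ → ℝ} {u u' : ℝ → ℂ}
    (h : IsHalfLineSolution W 0 u u' 0) (hW0 : ∀ x, 0 ≤ W x) (x : ℝ) :
    inner ℝ (u x) (u' x) ≤ 0 := by
  by_contra! hx
  have hmono : Monotone fun x => inner ℝ (u x) (u' x) :=
    monotone_of_hasDerivAt_nonneg (fun y => h.hasDerivAt_inner y) fun y => by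
      have := hW0 y
      simp only [Pi.zero_apply, inner_zero_right, sub_zero]
      positivity
  obtain ⟨T, hT, -, hlt⟩ := exists_lt_of_integrableOn_Ioi h.sq_integrable
    (show 0 < 2 * inner ℝ (u x) (u' x) by linarith) (x + 1)
  have h3 := intervalIntegral.integral_le_sub_of_hasDeriv_right_of_le
    (g := fun x => ‖u x‖ ^ 2) (φ := fun _ => 2 * inner ℝ (u x) (u' x)) (show x ≤ T by linarith)
    (fun y _ => (h.hasDerivAt_normSq y).continuousAt.continuousWithinAt)
    (fun y _ => (h.hasDerivAt_normSq y).hasDerivWithinAt) continuous_const.integrableOn_Icc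
    (fun y hy => by linarith [hmono hy.1.le])
  rw [intervalIntegral.integral_const, smul_eq_mul] at h3
  nlinarith [sq_nonneg ‖u x‖]

/-- The only square integrable solution of `u'' = V u` with `V ≥ 0` is `0`, because `|u|²` is
convex. -/
theorem eq_zero_of_sq_integrable {V : ℝ → ℝ} (hV0 : ∀ x, 0 ≤ V x) {u u' : ℝ → ℂ}
    (hu : ∀ x, HasDerivAt u (u' x) x) (hu' : ∀ x, HasDerivAt u' (V x • u x) x)
    (hsq : Integrable fun x => ‖u x‖ ^ 2) (x : ℝ) : u x = 0 := by
  have hz : Integrable fun x : ℝ => ‖(0 : ℝ → ℂ) x‖ ^ 2 := by simp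
  have h1 : IsHalfLineSolution V 0 u u' 0 :=
    ⟨hu, by simpa using hu', continuous_const, hsq.integrableOn, hz.integrableOn⟩
  have h2 : IsHalfLineSolution (fun x => V (-x)) 0 (fun x => u (-x)) (fun x => -u' (-x)) 0 :=
    isHalfLineSolution_comp_neg (f := 0) hu (by simpa using hu') continuous_const hsq hz
  have hN : ∀ x, inner ℝ (u x) (u' x) = 0 := fun x => by
    have e1 := h1.inner_nonpos hV0 x
    have e2 := h2.inner_nonpos (fun x => hV0 _) (-x)
    simp only [neg_neg, inner_neg_right] at e2
    linarith
  have hconst : ∀ y, ‖u y‖ ^ 2 = ‖u x‖ ^ 2 := fun y =>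
    is_const_of_deriv_eq_zero (f := fun x => ‖u x‖ ^ 2)
      (fun x => (h1.hasDerivAt_normSq x).differentiableAt)
      (fun x => by rw [(h1.hasDerivAt_normSq x).deriv, hN, mul_zero]) y x
  simp_rw [hconst] at hsq
  rw [integrable_const_iff] at hsq
  simpa [isFiniteMeasure_iff] using hsq

/-- `w n` is the classical (twice differentiable) representative of the eigenfunction `φ n`, and
`w' n` is its derivative. -/
structure IsClassicalEigenfamily (V : ℝ → ℝ) (φ : HilbertBasis ℕ ℂ L2) (lam : ℕ → ℝ)
    (w w' : ℕ → ℝ → ℂ) : Prop where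
  ae_eq : ∀ n, w n =ᵐ[volume] φ n
  hasDerivAt : ∀ n x, HasDerivAt (w n) (w' n x) x
  hasDerivAt_deriv : ∀ n x, HasDerivAt (w' n) ((V x - lam n ^ 2) • w n x) x

theorem IsEigenbasis.exists_classical {V : ℝ → ℝ} (hV : Continuous V)
    {φ : HilbertBasis ℕ ℂ L2} {lam : ℕ → ℝ} (hφ : IsEigenbasis V φ lam) :
    ∃ w w' : ℕ → ℝ → ℂ, IsClassicalEigenfamily V φ lam w w' := by
  choose w w' h1 h2 h3 using fun n => (hφ.eigen n).exists_classical hV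
  exact ⟨w, w', h1, h2, h3⟩

theorem norm_sum_smul_sq (φ : HilbertBasis ℕ ℂ L2) (s : Finset ℕ) (a : ℕ → ℂ) :
    ‖∑ n ∈ s, a n • φ n‖ ^ 2 = ∑ n ∈ s, ‖a n‖ ^ 2 := by
  have h := φ.orthonormal.inner_sum a a s
  rw [inner_self_eq_norm_sq_to_K] at h
  have h2 : ((‖∑ n ∈ s, a n • φ n‖ ^ 2 : ℝ) : ℂ) = ((∑ n ∈ s, ‖a n‖ ^ 2 : ℝ) : ℂ) := by
    push_cast
    rw [← Complex.coe_algebraMap]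
    refine h.trans (Finset.sum_congr rfl fun n _ => ?_)
    rw [Complex.conj_mul']; rfl
  exact_mod_cast h2

theorem L2.integral_norm_sq (U : L2) {u : ℝ → ℂ} (h : u =ᵐ[volume] U) :
    Integrable (fun x => ‖u x‖ ^ 2) ∧ ∫ x, ‖u x‖ ^ 2 = ‖U‖ ^ 2 := by
  have hae : (fun x => ‖u x‖ ^ 2) =ᵐ[volume] fun x => ‖U x‖ ^ 2 := by
    filter_upwards [h] with x hx
    rw [hx]
  refine ⟨((Lp.memLp U).integrable_norm_pow two_ne_zero).congr hae.symm, ?_⟩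
  rw [integral_congr_ae hae]
  have h1 := L2.inner_def (𝕜 := ℂ) U U
  rw [inner_self_eq_norm_sq_to_K] at h1
  have h2 : ∀ x, inner ℂ (U x) (U x) = ((‖U x‖ ^ 2 : ℝ) : ℂ) := fun x => by
    rw [inner_self_eq_norm_sq_to_K]; push_cast; rfl
  simp_rw [h2] at h1
  rw [integral_complex_ofReal] at h1
  have h3 : ((‖U‖ ^ 2 : ℝ) : ℂ) = ((∫ x, ‖U x‖ ^ 2 : ℝ) : ℂ) := by
    rw [← h1]; push_cast; rfl
  exact_mod_cast h3.symm

theorem IsClassicalEigenfamily.integral_sum_sq {V : ℝ → ℝ} {φ : HilbertBasis ℕ ℂ L2}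
    {lam : ℕ → ℝ} {w w' : ℕ → ℝ → ℂ} (h : IsClassicalEigenfamily V φ lam w w') (s : Finset ℕ)
    (a : ℕ → ℂ) :
    Integrable (fun x => ‖∑ n ∈ s, a n * w n x‖ ^ 2) ∧
      ∫ x, ‖∑ n ∈ s, a n * w n x‖ ^ 2 = ∑ n ∈ s, ‖a n‖ ^ 2 := by
  rw [← norm_sum_smul_sq φ]
  refine L2.integral_norm_sq _ ?_
  have h1 : ∀ᵐ x, ∀ n, w n x = φ n x := ae_all_iff.2 fun n => h.ae_eq n
  have h2 : ∀ᵐ x, ∀ n, (a n • φ n : L2) x = a n • φ n x :=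
    ae_all_iff.2 fun n => Lp.coeFn_smul (a n) (φ n)
  filter_upwards [h1, h2, Lp.coeFn_fun_finsetSum s (fun n => a n • φ n)] with x h1 h2 h3
  rw [h3]
  exact Finset.sum_congr rfl fun n _ => by rw [h1, h2, smul_eq_mul]

section Spectrum

variable {V : ℝ → ℝ} {k : ℝ} {φ : HilbertBasis ℕ ℂ L2} {lam : ℕ → ℝ}

theorem IsEigenbasis.lam_pos (hV : Continuous V) (hV0 : ∀ x, 0 ≤ V x)
    (hφ : IsEigenbasis V φ lam) (n : ℕ) : 0 < lam n := by
  obtain ⟨w, w', h⟩ := hφ.exists_classical hV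
  refine (hφ.nonneg n).lt_of_ne fun h0 => ?_
  obtain ⟨h1, h2⟩ := L2.integral_norm_sq (φ n) (h.ae_eq n)
  have hz := eq_zero_of_sq_integrable hV0 (h.hasDerivAt n)
    (fun x => by simpa [← h0] using h.hasDerivAt_deriv n x) h1
  simp [hz, φ.orthonormal.1 n] at h2

/-- Spectral gaps: a spectral window of a fixed small width contains at most two eigenvalues,
since among three eigenfunctions some nontrivial combination has vanishing Cauchy data at `0`, and
the a priori bounds on the two half lines apply to it. -/
theorem IsEigenbasis.exists_window (hV : IsConfining V k) (hVk : IsAsymptoticToPower V k)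
    (hφ : IsEigenbasis V φ lam) :
    ∃ δ : ℝ, 0 < δ ∧ ∀ E : ℝ, 0 ≤ E → ∀ s : Finset ℕ, (∀ n ∈ s, |lam n ^ 2 - E| ≤ δ) →
      s.card ≤ 2 := by
  obtain ⟨w, w', h⟩ := hφ.exists_classical hV.smooth.continuous
  obtain ⟨K₁, hK₁, H₁⟩ := (hV.growsLikePower hVk).exists_apriori_bound
  obtain ⟨K₂, hK₂, H₂⟩ := (hV.growsLikePower_comp_neg hVk).exists_apriori_bound
  set K := max K₁ K₂ with hK
  have hK0 : 0 < K := hK₁.trans_le (le_max_left _ _)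
  refine ⟨1 / (K + 1), by positivity, fun E hE s hs => ?_⟩
  by_contra! hcard
  have hdep : ¬ LinearIndepOn ℂ (fun n => (w n 0, w' n 0)) (s : Set ℕ) := fun hli => by
    have := hli.linearIndependent.fintype_card_le_finrank
    simp at this
    omega
  rw [linearIndepOn_finset_iff] at hdep
  push Not at hdep
  obtain ⟨g, hg, m, hm, hgm⟩ := hdep
  have hg1 : ∑ n ∈ s, g n * w n 0 = 0 := by
    simpa [Prod.fst_sum] using congrArg Prod.fst hg
  have hg2 : ∑ n ∈ s, g n * w' n 0 = 0 := by
    simpa [Prod.snd_sum] using congrArg Prod.snd hg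
  set b : ℕ → ℂ := fun n => g n * ((lam n ^ 2 - E : ℝ) : ℂ) with hb
  set u : ℝ → ℂ := fun x => ∑ n ∈ s, g n * w n x with hu
  set u' : ℝ → ℂ := fun x => ∑ n ∈ s, g n * w' n x with hu'
  set f : ℝ → ℂ := fun x => ∑ n ∈ s, b n * w n x with hf
  have du : ∀ x, HasDerivAt u (u' x) x := fun x =>
    HasDerivAt.fun_sum fun n _ => (h.hasDerivAt n x).const_mul (g n)
  have du' : ∀ x, HasDerivAt u' ((V x - E) • u x - f x) x := fun x => by
    refine (HasDerivAt.fun_sum fun n _ => (h.hasDerivAt_deriv n x).const_mul (g n)).congr_deriv ?_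
    rw [hu, hf, Finset.smul_sum, ← Finset.sum_sub_distrib]
    refine Finset.sum_congr rfl fun n _ => ?_
    simp only [hb, Complex.real_smul]
    push_cast
    ring
  have cf : Continuous f := continuous_finsetSum _ fun n _ => continuous_const.mul
    (continuous_iff_continuousAt.2 fun x => (h.hasDerivAt n x).continuousAt)
  obtain ⟨iu, eu⟩ := h.integral_sum_sq s g
  obtain ⟨jf, ef⟩ := h.integral_sum_sq s b
  have e1 := H₁ E u u' f hE ⟨du, du', cf, iu.integrableOn, jf.integrableOn⟩ hg1 hg2
  have e2 := H₂ E _ _ _ hE (isHalfLineSolution_comp_neg du du' cf iu jf) (by simpa using hg1)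
    (by simpa using hg2)
  have n1 : 0 ≤ ∫ x in Set.Ioi 0, ‖f x‖ ^ 2 :=
    setIntegral_nonneg measurableSet_Ioi fun x _ => sq_nonneg _
  have n2 : 0 ≤ ∫ x in Set.Ioi 0, ‖f (-x)‖ ^ 2 :=
    setIntegral_nonneg measurableSet_Ioi fun x _ => sq_nonneg _
  have s1 := integral_Ioi_add_comp_neg iu
  have s2 := integral_Ioi_add_comp_neg jf
  have m1 := mul_le_mul_of_nonneg_right (le_max_left K₁ K₂) n1
  have m2 := mul_le_mul_of_nonneg_right (le_max_right K₁ K₂) n2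
  have total : ∑ n ∈ s, ‖g n‖ ^ 2 ≤ K * ∑ n ∈ s, ‖b n‖ ^ 2 := by
    rw [← eu, ← ef, ← s1, ← s2, mul_add]
    exact add_le_add (e1.trans m1) (e2.trans m2)
  have hbg : ∑ n ∈ s, ‖b n‖ ^ 2 ≤ (1 / (K + 1)) ^ 2 * ∑ n ∈ s, ‖g n‖ ^ 2 := by
    rw [Finset.mul_sum]
    refine Finset.sum_le_sum fun n hn => ?_
    rw [hb, norm_mul, mul_pow, Complex.norm_real, Real.norm_eq_abs, mul_comm]
    exact mul_le_mul_of_nonneg_right (pow_le_pow_left₀ (abs_nonneg _) (hs n hn) 2) (sq_nonneg _)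
  have hpos : 0 < ∑ n ∈ s, ‖g n‖ ^ 2 :=
    Finset.sum_pos' (fun n _ => sq_nonneg _) ⟨m, hm, by positivity⟩
  have hlt : K * (1 / (K + 1)) ^ 2 < 1 := by
    rw [one_div, inv_pow, ← div_eq_mul_inv, div_lt_one (by positivity)]
    nlinarith
  have := mul_le_mul_of_nonneg_left hbg hK0.le
  nlinarith

/-- The eigenvalues are positive, and only finitely many lie in a window at `0`. -/
theorem IsEigenbasis.exists_lam_lower_bound (hV : IsConfining V k)
    (hVk : IsAsymptoticToPower V k) (hφ : IsEigenbasis V φ lam) :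
    ∃ c : ℝ, 0 < c ∧ ∀ n, c ≤ lam n := by
  obtain ⟨δ, hδ, H⟩ := hφ.exists_window hV hVk
  have hpos := hφ.lam_pos hV.smooth.continuous hV.nonneg
  have hfin : {n | lam n ^ 2 ≤ δ}.Finite := by
    by_contra hinf
    obtain ⟨t, ht, hc⟩ := Set.Infinite.exists_subset_card_eq hinf 3
    -- the window at `E = 0` contains at most two eigenvalues
    have := H 0 le_rfl t fun n hn => by
      rw [sub_zero, abs_of_nonneg (sq_nonneg _)]
      exact ht hn
    omega
  obtain ⟨c, hc, hcn⟩ : ∃ c : ℝ, 0 < c ∧ ∀ n ∈ hfin.toFinset, c ≤ lam n := by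
    rcases hfin.toFinset.eq_empty_or_nonempty with he | hne
    · exact ⟨1, one_pos, by simp [he]⟩
    · obtain ⟨m, -, hm⟩ := Finset.exists_min_image _ lam hne
      exact ⟨lam m, hpos m, hm⟩
  refine ⟨min c (Real.sqrt δ), lt_min hc (Real.sqrt_pos.2 hδ), fun n => ?_⟩
  rcases le_or_gt (lam n ^ 2) δ with h | h
  · exact (min_le_left _ _).trans (hcn n (by simpa using h))
  · exact (min_le_right _ _).trans (Real.sqrt_le_iff.2 ⟨(hpos n).le, h.le⟩)

end Spectrum

/-! ### Exponential sums with separated frequencies -/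

theorem summable_exp_neg_mul_int_sq {c : ℝ} (hc : 0 < c) :
    Summable fun d : ℤ => Real.exp (-(c * (d : ℝ) ^ 2)) := by
  have h1 : Summable fun d : ℤ => c⁻¹ * (1 / (d : ℝ) ^ 2) :=
    (Real.summable_one_div_int_pow.2 one_lt_two).mul_left _
  refine h1.of_norm_bounded_eventually ?_
  filter_upwards [(Set.finite_singleton (0 : ℤ)).compl_mem_cofinite] with d hd
  have hd0 : (d : ℝ) ≠ 0 := by exact_mod_cast hd
  have hpos : 0 < c * (d : ℝ) ^ 2 := by positivity
  rw [Real.norm_of_nonneg (Real.exp_pos _).le, Real.exp_neg]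
  have h2 : c * (d : ℝ) ^ 2 ≤ Real.exp (c * (d : ℝ) ^ 2) := by
    linarith [Real.add_one_le_exp (c * (d : ℝ) ^ 2)]
  calc (Real.exp (c * (d : ℝ) ^ 2))⁻¹ ≤ (c * (d : ℝ) ^ 2)⁻¹ := inv_anti₀ hpos h2
    _ = c⁻¹ * (1 / (d : ℝ) ^ 2) := by rw [mul_inv, one_div]

/-- A sequence of nonnegative reals with boundedly many terms in each window of width `δ` has
uniformly bounded sums of Gaussian weights centred at its terms. -/
theorem exists_sum_gaussian_le {μ : ℕ → ℝ} (hμ : ∀ n, 0 ≤ μ n) {δ : ℝ} (hδ : 0 < δ) {N : ℕ}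
    (H : ∀ E : ℝ, 0 ≤ E → ∀ s : Finset ℕ, (∀ n ∈ s, |μ n - E| ≤ δ) → s.card ≤ N) :
    ∃ B : ℝ, ∀ (s : Finset ℕ) (n : ℕ), ∑ m ∈ s, Real.exp (-((μ m - μ n) ^ 2 / 4)) ≤ B := by
  set F : ℤ → ℝ := fun d => Real.exp (-(δ ^ 2 / 8 * (d : ℝ) ^ 2)) with hF
  have hsum : Summable F := summable_exp_neg_mul_int_sq (by positivity)
  refine ⟨Real.exp (δ ^ 2 / 4) * (N * ∑' d, F d), fun s n => ?_⟩
  set j : ℕ → ℕ := fun m => ⌊μ m / δ⌋₊ with hj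
  have hj1 : ∀ m, δ * j m ≤ μ m := fun m => by
    have := Nat.floor_le (div_nonneg (hμ m) hδ.le)
    rw [le_div_iff₀ hδ] at this
    linarith
  have hj2 : ∀ m, μ m ≤ δ * j m + δ := fun m => by
    have := (Nat.lt_floor_add_one (μ m / δ)).le
    rw [div_le_iff₀ hδ] at this
    linarith
  set d : ℕ → ℤ := fun m => (j m : ℤ) - j n with hd
  have hterm : ∀ m, Real.exp (-((μ m - μ n) ^ 2 / 4)) ≤ Real.exp (δ ^ 2 / 4) * F (d m) := by
    intro m
    rw [hF, ← Real.exp_add, Real.exp_le_exp, hd]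
    push_cast
    -- `δ |d| ≤ |μ m - μ n| + δ`, hence `δ² d² / 2 ≤ (μ m - μ n)² + δ²`
    have h1 : |δ * ((j m : ℝ) - j n)| ≤ |μ m - μ n| + δ := by
      have a1 := le_abs_self (μ m - μ n)
      have a2 := neg_abs_le (μ m - μ n)
      rw [abs_le]
      constructor <;> linarith [hj1 m, hj2 m, hj1 n, hj2 n]
    have h2 := sq_le_sq'
      (by linarith [abs_nonneg (δ * ((j m : ℝ) - j n)), abs_nonneg (μ m - μ n)]) h1
    rw [sq_abs] at h2
    have h3 := sq_abs (μ m - μ n)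
    nlinarith [sq_nonneg (|μ m - μ n| - δ)]
  have hfib : ∀ b : ℤ, (s.filter fun m => d m = b).card ≤ N := by
    intro b
    rcases (s.filter fun m => d m = b).eq_empty_or_nonempty with he | ⟨m₀, hm₀⟩
    · simp [he]
    · refine H (δ * j m₀) (by positivity) _ fun m hm => ?_
      have h1 : (j m : ℤ) = j m₀ := by
        have a1 := (Finset.mem_filter.1 hm).2
        have a2 := (Finset.mem_filter.1 hm₀).2
        simp only [hd] at a1 a2
        omega
      have h2 : j m = j m₀ := by exact_mod_cast h1
      rw [← h2, abs_le]
      constructor <;> linarith [hj1 m, hj2 m]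
  calc ∑ m ∈ s, Real.exp (-((μ m - μ n) ^ 2 / 4))
      ≤ ∑ m ∈ s, Real.exp (δ ^ 2 / 4) * F (d m) := Finset.sum_le_sum fun m _ => hterm m
    _ = Real.exp (δ ^ 2 / 4) * ∑ b ∈ s.image d, (s.filter fun m => d m = b).card • F b := by
        rw [← Finset.mul_sum, Finset.sum_comp F d]
    _ ≤ Real.exp (δ ^ 2 / 4) * (N * ∑' d, F d) := by
        refine mul_le_mul_of_nonneg_left ?_ (Real.exp_pos _).le
        calc ∑ b ∈ s.image d, (s.filter fun m => d m = b).card • F b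
            ≤ ∑ b ∈ s.image d, N * F b := Finset.sum_le_sum fun b _ => by
              rw [nsmul_eq_mul]
              exact mul_le_mul_of_nonneg_right (by exact_mod_cast hfib b) (Real.exp_pos _).le
          _ ≤ N * ∑' d, F d := by
              rw [← Finset.mul_sum]
              exact mul_le_mul_of_nonneg_left
                (hsum.sum_le_tsum _ fun b _ => (Real.exp_pos _).le) (by positivity)

theorem integral_gaussian_mul_exp (ξ : ℝ) :
    Integrable (fun t : ℝ => Complex.exp (Complex.I * ξ * t) * Complex.exp (-1 * (t : ℂ) ^ 2)) ∧
      ‖∫ t : ℝ, Complex.exp (Complex.I * ξ * t) * Complex.exp (-1 * (t : ℂ) ^ 2)‖ =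
        Real.sqrt Real.pi * Real.exp (-(ξ ^ 2 / 4)) := by
  constructor
  · refine (integrable_cexp_quadratic' (b := -1) (by simp) (Complex.I * ξ) 0).congr
      (ae_of_all _ fun t => ?_)
    simp only
    rw [← Complex.exp_add]
    congr 1
    ring
  · rw [fourierIntegral_gaussian (by simp), norm_mul, Complex.norm_exp]
    congr 1
    · rw [div_one, Complex.norm_cpow_eq_rpow_re_of_pos Real.pi_pos, Real.sqrt_eq_rpow]
      norm_num
    · congr 1
      have : -(ξ : ℂ) ^ 2 / (4 * 1) = ((-(ξ ^ 2 / 4) : ℝ) : ℂ) := by push_cast; ring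
      rw [this, Complex.ofReal_re]

/-- A Bessel inequality for exponential sums whose frequencies have bounded multiplicity in
windows: a Gaussian majorant of the interval makes the exponentials almost orthogonal, and Schur's
test applies. -/
theorem exists_exponential_sum_bound {μ : ℕ → ℝ} {G : ℝ}
    (H : ∀ (s : Finset ℕ) (n : ℕ), ∑ m ∈ s, Real.exp (-((μ m - μ n) ^ 2 / 4)) ≤ G) :
    ∃ B : ℝ, ∀ (s : Finset ℕ) (a : ℕ → ℂ),
      ∫⁻ t in Set.Ioo 0 (2 * Real.pi),
        ‖∑ n ∈ s, Complex.exp (-(Complex.I * (t : ℂ) * (μ n : ℂ))) * a n‖ₑ ^ 2 ≤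
      ENNReal.ofReal B * ∑ n ∈ s, ‖a n‖ₑ ^ 2 := by
  -- `M e^{-t²} ≥ 1` on `(0, 2π)`
  set M := Real.exp ((2 * Real.pi) ^ 2) with hM
  refine ⟨M * (Real.sqrt Real.pi * |G|), fun s a => ?_⟩
  set e : ℕ → ℝ → ℂ := fun n t => Complex.exp (-(Complex.I * (t : ℂ) * (μ n : ℂ))) with he
  set S : ℝ → ℂ := fun t => ∑ n ∈ s, e n t * a n with hS
  set g : ℝ → ℝ := fun t => Real.exp (-t ^ 2) * ‖S t‖ ^ 2 with hg
  -- the double sum for the Gaussian weighted integral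
  have hexp : ∀ t, (g t : ℂ) = ∑ n ∈ s, ∑ m ∈ s, (a n * (starRingEnd ℂ) (a m)) *
      (Complex.exp (Complex.I * ((μ m - μ n : ℝ) : ℂ) * t) * Complex.exp (-1 * (t : ℂ) ^ 2)) := by
    intro t
    have h1 : ((‖S t‖ ^ 2 : ℝ) : ℂ) = S t * (starRingEnd ℂ) (S t) := by
      rw [Complex.mul_conj']; push_cast; rfl
    have h0 : (g t : ℂ) = S t * (starRingEnd ℂ) (S t) * Complex.exp (-1 * (t : ℂ) ^ 2) := by
      rw [← h1, hg]
      push_cast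
      ring_nf
    rw [h0, hS]
    simp only [map_sum, map_mul]
    rw [Finset.sum_mul_sum, Finset.sum_mul]
    refine Finset.sum_congr rfl fun n _ => ?_
    rw [Finset.sum_mul]
    refine Finset.sum_congr rfl fun m _ => ?_
    have h2 : (starRingEnd ℂ) (e m t) = Complex.exp (Complex.I * (t : ℂ) * (μ m : ℂ)) := by
      simp only [he]
      rw [← Complex.exp_conj]
      simp
    have h3 : Complex.exp (Complex.I * ((μ m - μ n : ℝ) : ℂ) * t) =
        e n t * Complex.exp (Complex.I * (t : ℂ) * (μ m : ℂ)) := by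
      simp only [he]
      rw [← Complex.exp_add]
      congr 1
      push_cast
      ring
    rw [h2, h3]
    ring
  have hint : ∀ n m, Integrable fun t : ℝ => (a n * (starRingEnd ℂ) (a m)) *
      (Complex.exp (Complex.I * ((μ m - μ n : ℝ) : ℂ) * t) * Complex.exp (-1 * (t : ℂ) ^ 2)) :=
    fun n m => (integral_gaussian_mul_exp _).1.const_mul _
  have hgi : Integrable g := by
    have h1 : Integrable fun t => (g t : ℂ) := by
      simp_rw [hexp]
      exact integrable_finsetSum _ fun n _ => integrable_finsetSum _ fun m _ => hint n m
    simpa using h1.re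
  have hg0 : ∀ t, 0 ≤ g t := fun t => by positivity
  have hgle : ∫ t, g t ≤ Real.sqrt Real.pi * |G| * ∑ n ∈ s, ‖a n‖ ^ 2 := by
    have h1 : ((∫ t, g t : ℝ) : ℂ) = ∑ n ∈ s, ∑ m ∈ s, (a n * (starRingEnd ℂ) (a m)) *
        ∫ t : ℝ, Complex.exp (Complex.I * ((μ m - μ n : ℝ) : ℂ) * t) *
          Complex.exp (-1 * (t : ℂ) ^ 2) := by
      rw [← integral_complex_ofReal]
      simp_rw [hexp]
      rw [integral_finsetSum _ fun n _ => integrable_finsetSum _ fun m _ => hint n m]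
      refine Finset.sum_congr rfl fun n _ => ?_
      rw [integral_finsetSum _ fun m _ => hint n m]
      exact Finset.sum_congr rfl fun m _ => integral_const_mul _ _
    set Q : ℕ → ℕ → ℝ := fun n m => Real.exp (-((μ m - μ n) ^ 2 / 4)) with hQ
    have hQ0 : ∀ n m, 0 ≤ Q n m := fun n m => (Real.exp_pos _).le
    have hQs : ∀ n m, Q n m = Q m n := fun n m => by
      simp only [hQ]; congr 2; ring
    have h2 : ∫ t, g t ≤ ∑ n ∈ s, ∑ m ∈ s, Real.sqrt Real.pi *
        ((‖a n‖ ^ 2 * Q n m + ‖a m‖ ^ 2 * Q n m) / 2) := by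
      calc ∫ t, g t = ‖((∫ t, g t : ℝ) : ℂ)‖ := by
            rw [Complex.norm_real, Real.norm_of_nonneg (integral_nonneg hg0)]
        _ ≤ _ := by
            rw [h1]
            refine norm_sum_le_of_le _ fun n _ => norm_sum_le_of_le _ fun m _ => ?_
            rw [norm_mul, (integral_gaussian_mul_exp _).2, norm_mul, RCLike.norm_conj]
            have a1 : ‖a n‖ * ‖a m‖ ≤ (‖a n‖ ^ 2 + ‖a m‖ ^ 2) / 2 := by
              nlinarith [sq_nonneg (‖a n‖ - ‖a m‖)]
            have a2 := mul_le_mul_of_nonneg_right a1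
              (mul_nonneg (Real.sqrt_nonneg Real.pi) (hQ0 n m))
            refine a2.trans (le_of_eq ?_)
            ring
    have h3 : ∑ n ∈ s, ∑ m ∈ s, ‖a n‖ ^ 2 * Q n m ≤ |G| * ∑ n ∈ s, ‖a n‖ ^ 2 := by
      rw [Finset.mul_sum]
      refine Finset.sum_le_sum fun n _ => ?_
      rw [← Finset.mul_sum, mul_comm]
      exact mul_le_mul_of_nonneg_right ((H s n).trans (le_abs_self G)) (sq_nonneg _)
    have h4 : ∑ n ∈ s, ∑ m ∈ s, ‖a m‖ ^ 2 * Q n m = ∑ n ∈ s, ∑ m ∈ s, ‖a n‖ ^ 2 * Q n m := by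
      rw [Finset.sum_comm]
      exact Finset.sum_congr rfl fun n _ => Finset.sum_congr rfl fun m _ => by rw [hQs]
    simp_rw [← Finset.mul_sum, ← Finset.sum_div, Finset.sum_add_distrib] at h2
    rw [h4] at h2
    refine h2.trans ?_
    rw [mul_assoc]
    exact mul_le_mul_of_nonneg_left (by linarith) (Real.sqrt_nonneg _)
  have hpt : ∀ t ∈ Set.Ioo 0 (2 * Real.pi), ‖S t‖ₑ ^ 2 ≤ ENNReal.ofReal (M * g t) := by
    intro t ht
    rw [← ofReal_norm, ← ENNReal.ofReal_pow (norm_nonneg _)]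
    refine ENNReal.ofReal_le_ofReal ?_
    rw [hM, hg, ← mul_assoc, ← Real.exp_add]
    refine le_mul_of_one_le_left (sq_nonneg _) (Real.one_le_exp ?_)
    nlinarith [ht.1, ht.2]
  calc ∫⁻ t in Set.Ioo 0 (2 * Real.pi), ‖S t‖ₑ ^ 2
      ≤ ∫⁻ t in Set.Ioo 0 (2 * Real.pi), ENNReal.ofReal (M * g t) :=
        setLIntegral_mono' measurableSet_Ioo hpt
    _ ≤ ∫⁻ t, ENNReal.ofReal (M * g t) := setLIntegral_le_lintegral _ _
    _ = ENNReal.ofReal (∫ t, M * g t) := (ofReal_integral_eq_lintegral_ofReal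
        (hgi.const_mul M) (ae_of_all _ fun t => mul_nonneg (Real.exp_pos _).le (hg0 t))).symm
    _ ≤ _ := by
        have h0 : ∑ n ∈ s, ‖a n‖ₑ ^ 2 = ENNReal.ofReal (∑ n ∈ s, ‖a n‖ ^ 2) := by
          rw [ENNReal.ofReal_sum_of_nonneg fun n _ => sq_nonneg _]
          exact Finset.sum_congr rfl fun n _ => by
            rw [← ofReal_norm, ENNReal.ofReal_pow (norm_nonneg _)]
        rw [h0, ← ENNReal.ofReal_mul (by positivity)]
        refine ENNReal.ofReal_le_ofReal ?_
        rw [integral_const_mul]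
        have h1 := mul_le_mul_of_nonneg_left hgle (Real.exp_pos ((2 * Real.pi) ^ 2)).le
        rw [← hM] at h1
        linarith

/-! ### Space-time norms and the equivalence -/

theorem eLpNorm_two_sq {α : Type*} [MeasurableSpace α] (f : α → ℂ) (μ : Measure α) :
    eLpNorm f 2 μ ^ 2 = ∫⁻ x, ‖f x‖ₑ ^ 2 ∂μ := by
  have := eLpNorm_nnreal_pow_eq_lintegral (μ := μ) (f := f) (p := 2) two_ne_zero
  simpa using this

theorem one_le_bracket (x : ℝ) : 1 ≤ bracket x := Real.one_le_sqrt.2 (by nlinarith [sq_nonneg x])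

theorem rpow_le_bracket_rpow {y γ : ℝ} (hy : 0 ≤ y) (hγ : 0 < γ) :
    y ^ γ ≤ bracket (y ^ 2) ^ (γ / 2) := by
  have h1 : y ^ γ = (y ^ 2) ^ (γ / 2) := by
    rw [← Real.rpow_natCast_mul hy]; congr 1; push_cast; ring
  rw [h1]
  refine Real.rpow_le_rpow (sq_nonneg y) (Real.le_sqrt_of_sq_le ?_) (by positivity)
  linarith

theorem bracket_rpow_le {c γ : ℝ} (hc : 0 < c) (hγ : 0 < γ) :
    ∃ B : ℝ, 0 < B ∧ ∀ y, c ≤ y → bracket (y ^ 2) ^ (γ / 2) ≤ B * y ^ γ := by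
  set b := Real.sqrt (1 / c ^ 4 + 1) with hb
  have hb0 : 0 < b := Real.sqrt_pos.2 (by positivity)
  refine ⟨b ^ (γ / 2), by positivity, fun y hy => ?_⟩
  have hy0 : 0 < y := hc.trans_le hy
  have h1 : y ^ γ = (y ^ 2) ^ (γ / 2) := by
    rw [← Real.rpow_natCast_mul hy0.le]; congr 1; push_cast; ring
  rw [h1, ← Real.mul_rpow hb0.le (sq_nonneg y)]
  refine Real.rpow_le_rpow (Real.sqrt_nonneg _) ?_ (by positivity)
  refine Real.sqrt_le_iff.2 ⟨by positivity, ?_⟩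
  rw [mul_pow, hb, Real.sq_sqrt (by positivity)]
  have h2 : c ^ 4 ≤ y ^ 4 := pow_le_pow_left₀ hc.le hy 4
  have h3 : 1 ≤ 1 / c ^ 4 * y ^ 4 := by
    rw [one_div, ← div_eq_inv_mul, le_div_iff₀ (by positivity)]; linarith
  nlinarith

/-- The measure on space-time `(0, 2π) × ℝ`. -/
noncomputable def spaceTime : Measure (ℝ × ℝ) :=
  ((volume : Measure ℝ).restrict (Set.Ioo 0 (2 * Real.pi))).prod (volume : Measure ℝ)

/-- The function `(t, x) ↦ e^{-itλ_n²} Ψ(x) φ_n(x)` on space-time. -/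
noncomputable def weightedMode (φ : HilbertBasis ℕ ℂ L2) (lam : ℕ → ℝ) (Ψ : ℝ → ℝ) (n : ℕ)
    (z : ℝ × ℝ) : ℂ :=
  Complex.exp (-(Complex.I * (z.1 : ℂ) * ((lam n ^ 2 : ℝ) : ℂ))) * ((Ψ z.2 : ℂ) * φ n z.2)

theorem lintegral_eLpNorm_sq {F : ℝ → ℝ → ℂ}
    (hF : AEStronglyMeasurable (Function.uncurry F) spaceTime) :
    ∫⁻ t in Set.Ioo 0 (2 * Real.pi), eLpNorm (F t) 2 volume ^ 2 =
      eLpNorm (Function.uncurry F) 2 spaceTime ^ 2 := by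
  rw [eLpNorm_two_sq, spaceTime, lintegral_prod _ (hF.enorm.pow_const 2)]
  simp_rw [eLpNorm_two_sq]
  rfl

section Equivalence

variable {φ : HilbertBasis ℕ ℂ L2} {lam : ℕ → ℝ} {Ψ : ℝ → ℝ} {γ : ℝ}

theorem stronglyMeasurable_weightedMode (hΨ : Continuous Ψ) (n : ℕ) :
    StronglyMeasurable (weightedMode φ lam Ψ n) := by
  have h1 : StronglyMeasurable fun z : ℝ × ℝ => φ n z.2 :=
    (Lp.stronglyMeasurable (φ n)).comp_measurable measurable_snd
  have h2 : Continuous fun z : ℝ × ℝ =>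
    Complex.exp (-(Complex.I * (z.1 : ℂ) * ((lam n ^ 2 : ℝ) : ℂ))) := by fun_prop
  have h3 : Continuous fun z : ℝ × ℝ => (Ψ z.2 : ℂ) := by fun_prop
  exact h2.stronglyMeasurable.mul (h3.stronglyMeasurable.mul h1)

theorem mul_partialFlow (f : L2) (s : Finset ℕ) (t x : ℝ) :
    (Ψ x : ℂ) * partialFlow φ lam γ f s t x =
      ∑ n ∈ s, (((bracket (lam n ^ 2) ^ (γ / 2) : ℝ) : ℂ) * φ.repr f n) *
        weightedMode φ lam Ψ n (t, x) := by
  rw [partialFlow, Finset.mul_sum]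
  refine Finset.sum_congr rfl fun n _ => ?_
  rw [weightedMode]
  ring

/-- Since `|e^{-itλ_n²}| = 1`, the space-time norm of one mode is `√(2π) ‖Ψ φ_n‖`. -/
theorem eLpNorm_weightedMode_sq (hΨ : Continuous Ψ) (n : ℕ) :
    eLpNorm (weightedMode φ lam Ψ n) 2 spaceTime ^ 2 =
      ENNReal.ofReal (2 * Real.pi) * eLpNorm (fun x => (Ψ x : ℂ) * φ n x) 2 volume ^ 2 := by
  have h := lintegral_eLpNorm_sq (F := fun t x => weightedMode φ lam Ψ n (t, x))
    (stronglyMeasurable_weightedMode hΨ n).aestronglyMeasurable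
  have h2 : ∀ t : ℝ, eLpNorm (fun x => weightedMode φ lam Ψ n (t, x)) 2 volume =
      eLpNorm (fun x => (Ψ x : ℂ) * φ n x) 2 volume := fun t => by
    refine eLpNorm_congr_norm_ae (ae_of_all _ fun x => ?_)
    rw [weightedMode, norm_mul, Complex.norm_exp]
    simp [-Complex.ofReal_pow]
  simp_rw [h2] at h
  rw [setLIntegral_const, Real.volume_Ioo, sub_zero] at h
  rw [mul_comm, h]
  rfl

theorem SmoothingEstimate.eigenfunctionDecay (hΨ : Continuous Ψ) (hγ : 0 < γ)
    (hpos : ∀ n, 0 < lam n) (h : SmoothingEstimate φ lam γ Ψ) :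
    EigenfunctionDecay φ lam γ Ψ := by
  obtain ⟨C, hC, H⟩ := h
  refine ⟨C, hC, fun n => ?_⟩
  obtain ⟨U, ⟨hUm, hUlim⟩, hUle⟩ := H (φ n)
  change AEStronglyMeasurable (Function.uncurry U) spaceTime at hUm
  set c := bracket (lam n ^ 2) ^ (γ / 2) with hc
  have hcl : lam n ^ γ ≤ c := rpow_le_bracket_rpow (hpos n).le hγ
  have hlp : 0 < lam n ^ γ := Real.rpow_pos_of_pos (hpos n) γ
  have hc0 : 0 < c := hlp.trans_le hcl
  set g : ℝ × ℝ → ℂ := fun z => (c : ℂ) * weightedMode φ lam Ψ n z with hg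
  have hgm : StronglyMeasurable g :=
    stronglyMeasurable_const.mul (stronglyMeasurable_weightedMode hΨ n)
  -- the expansion of `φ n` has a single term
  have hflow : ∀ s : Finset ℕ, n ∈ s → ∀ t x,
      (Ψ x : ℂ) * partialFlow φ lam γ (φ n) s t x = g (t, x) := by
    intro s hs t x
    rw [mul_partialFlow, Finset.sum_eq_single n]
    · simp [hg, hc, φ.repr_self, lp.single_apply]
    · intro m _ hm
      simp [φ.repr_self, lp.single_apply, hm]
    · exact fun h => absurd hs h
  have hzero : eLpNorm (g - Function.uncurry U) 2 spaceTime ^ 2 = 0 := by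
    have h1 : ∀ᶠ s : Finset ℕ in atTop, ∫⁻ t in Set.Ioo 0 (2 * Real.pi),
        eLpNorm (fun x => (Ψ x : ℂ) * partialFlow φ lam γ (φ n) s t x - U t x) 2 volume ^ 2 =
        eLpNorm (g - Function.uncurry U) 2 spaceTime ^ 2 := by
      filter_upwards [eventually_ge_atTop {n}] with s hs
      simp_rw [hflow s (Finset.singleton_subset_iff.1 hs)]
      exact lintegral_eLpNorm_sq (F := fun t x => g (t, x) - U t x)
        (hgm.aestronglyMeasurable.sub hUm)
    exact tendsto_nhds_unique (tendsto_const_nhds.congr' (h1.mono fun _ h => h.symm)) hUlim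
  have hae : g =ᵐ[spaceTime] Function.uncurry U := by
    rw [pow_eq_zero_iff two_ne_zero,
      eLpNorm_eq_zero_iff (hgm.aestronglyMeasurable.sub hUm) two_ne_zero] at hzero
    filter_upwards [hzero] with z hz
    exact sub_eq_zero.1 hz
  have hle : eLpNorm g 2 spaceTime ≤ ENNReal.ofReal C := by
    rw [lintegral_eLpNorm_sq hUm, ← eLpNorm_congr_ae hae, ← ENNReal.rpow_natCast,
      ← ENNReal.rpow_mul, φ.orthonormal.1 n] at hUle
    simpa using hUle
  have hge : ENNReal.ofReal (lam n ^ γ) * eLpNorm (fun x => (Ψ x : ℂ) * φ n x) 2 volume ≤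
      eLpNorm g 2 spaceTime := by
    have e1 : eLpNorm g 2 spaceTime =
        ENNReal.ofReal c * eLpNorm (weightedMode φ lam Ψ n) 2 spaceTime := by
      have := eLpNorm_const_smul (c : ℂ) (weightedMode φ lam Ψ n) 2 spaceTime
      rw [← ofReal_norm, Complex.norm_real, Real.norm_of_nonneg hc0.le] at this
      exact this
    rw [e1]
    refine mul_le_mul' (ENNReal.ofReal_le_ofReal hcl) ?_
    refine (ENNReal.pow_le_pow_left_iff two_ne_zero).1 ?_
    rw [eLpNorm_weightedMode_sq hΨ]
    refine le_mul_of_one_le_left' ?_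
    rw [ENNReal.one_le_ofReal]
    linarith [Real.pi_gt_three]
  have hfin := hge.trans hle
  rw [mul_comm, ← ENNReal.le_div_iff_mul_le (Or.inl (by simpa using hlp))
    (Or.inl ENNReal.ofReal_ne_top),
    ← ENNReal.ofReal_div_of_pos hlp] at hfin
  rwa [Real.rpow_neg (hpos n).le, ← div_eq_mul_inv]

/-- Almost orthogonality in time, integrated over space. -/
theorem eLpNorm_sum_weightedMode_sq_le (hΨ : Continuous Ψ) {B D : ℝ≥0∞} {c : ℕ → ℝ}
    (hB : ∀ (s : Finset ℕ) (a : ℕ → ℂ), ∫⁻ t in Set.Ioo 0 (2 * Real.pi),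
        ‖∑ n ∈ s, Complex.exp (-(Complex.I * (t : ℂ) * ((lam n ^ 2 : ℝ) : ℂ))) * a n‖ₑ ^ 2 ≤
      B * ∑ n ∈ s, ‖a n‖ₑ ^ 2)
    (hD : ∀ n, ‖c n‖ₑ * eLpNorm (fun x => (Ψ x : ℂ) * φ n x) 2 volume ≤ D)
    (s : Finset ℕ) (a : ℕ → ℂ) :
    eLpNorm (fun z => ∑ n ∈ s, ((c n : ℂ) * a n) * weightedMode φ lam Ψ n z) 2 spaceTime ^ 2 ≤
      B * D ^ 2 * ∑ n ∈ s, ‖a n‖ₑ ^ 2 := by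
  have hm : StronglyMeasurable fun z => ∑ n ∈ s, ((c n : ℂ) * a n) * weightedMode φ lam Ψ n z :=
    Finset.stronglyMeasurable_fun_sum s fun n _ =>
      stronglyMeasurable_const.mul (stronglyMeasurable_weightedMode hΨ n)
  have hx : ∀ n, Measurable fun x => ‖(Ψ x : ℂ) * φ n x‖ₑ ^ 2 := fun n => by
    have h1 : Continuous fun x => (Ψ x : ℂ) := by fun_prop
    exact ((h1.stronglyMeasurable.mul (Lp.stronglyMeasurable (φ n))).enorm).pow_const 2
  rw [eLpNorm_two_sq, spaceTime, lintegral_prod_symm _ (hm.enorm.pow_const 2).aemeasurable]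
  calc ∫⁻ x, ∫⁻ t in Set.Ioo 0 (2 * Real.pi),
        ‖∑ n ∈ s, ((c n : ℂ) * a n) * weightedMode φ lam Ψ n (t, x)‖ₑ ^ 2
      ≤ ∫⁻ x, B * ∑ n ∈ s, (‖c n‖ₑ * ‖a n‖ₑ) ^ 2 * ‖(Ψ x : ℂ) * φ n x‖ₑ ^ 2 := by
        refine lintegral_mono fun x => ?_
        have h1 := hB s fun n => ((c n : ℂ) * a n) * ((Ψ x : ℂ) * φ n x)
        have h2 : ∀ t : ℝ, ∑ n ∈ s, Complex.exp (-(Complex.I * (t : ℂ) * ((lam n ^ 2 : ℝ) : ℂ))) *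
            (((c n : ℂ) * a n) * ((Ψ x : ℂ) * φ n x)) =
            ∑ n ∈ s, ((c n : ℂ) * a n) * weightedMode φ lam Ψ n (t, x) := fun t =>
          Finset.sum_congr rfl fun n _ => by rw [weightedMode]; ring
        simp_rw [h2] at h1
        refine h1.trans (le_of_eq ?_)
        congr 1
        refine Finset.sum_congr rfl fun n _ => ?_
        have h3 : ‖(c n : ℂ)‖ₑ = ‖c n‖ₑ := by
          rw [← ofReal_norm, ← ofReal_norm, Complex.norm_real]
        rw [enorm_mul, enorm_mul, h3, mul_pow]
    _ = B * ∑ n ∈ s, (‖c n‖ₑ * eLpNorm (fun x => (Ψ x : ℂ) * φ n x) 2 volume) ^ 2 *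
          ‖a n‖ₑ ^ 2 := by
        rw [lintegral_const_mul _ (Finset.measurable_fun_sum s fun n _ => (hx n).const_mul _),
          lintegral_finsetSum _ fun n _ => (hx n).const_mul _]
        congr 1
        refine Finset.sum_congr rfl fun n _ => ?_
        rw [lintegral_const_mul _ (hx n), ← eLpNorm_two_sq]
        ring
    _ ≤ B * ∑ n ∈ s, D ^ 2 * ‖a n‖ₑ ^ 2 := by
        gcongr with n _
        exact hD n
    _ = B * D ^ 2 * ∑ n ∈ s, ‖a n‖ₑ ^ 2 := by rw [← Finset.mul_sum, mul_assoc]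

/-- Almost orthogonality bounds the partial sums of the expansion by the `ℓ²` norm of the
coefficients, so the series converges unconditionally. -/
theorem EigenfunctionDecay.smoothingEstimate (hΨ : Continuous Ψ) (hγ : 0 < γ) {c₀ B : ℝ}
    (hc₀ : 0 < c₀) (hlam : ∀ n, c₀ ≤ lam n)
    (hB : ∀ (s : Finset ℕ) (a : ℕ → ℂ), ∫⁻ t in Set.Ioo 0 (2 * Real.pi),
        ‖∑ n ∈ s, Complex.exp (-(Complex.I * (t : ℂ) * ((lam n ^ 2 : ℝ) : ℂ))) * a n‖ₑ ^ 2 ≤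
      ENNReal.ofReal B * ∑ n ∈ s, ‖a n‖ₑ ^ 2)
    (h : EigenfunctionDecay φ lam γ Ψ) : SmoothingEstimate φ lam γ Ψ := by
  obtain ⟨C, hC, H⟩ := h
  obtain ⟨b, hb, Hb⟩ := bracket_rpow_le hc₀ hγ
  set c : ℕ → ℝ := fun n => bracket (lam n ^ 2) ^ (γ / 2) with hc
  have hD : ∀ n, ‖c n‖ₑ * eLpNorm (fun x => (Ψ x : ℂ) * φ n x) 2 volume ≤
      ENNReal.ofReal (b * C) := by
    intro n
    have hl : 0 < lam n := hc₀.trans_le (hlam n)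
    have hlγ : 0 < lam n ^ γ := Real.rpow_pos_of_pos hl γ
    have hcn : 0 ≤ c n :=
      Real.rpow_nonneg (zero_le_one.trans (one_le_bracket _)) _
    calc ‖c n‖ₑ * eLpNorm (fun x => (Ψ x : ℂ) * φ n x) 2 volume
        ≤ ENNReal.ofReal (b * lam n ^ γ) * ENNReal.ofReal (C * lam n ^ (-γ)) := by
          refine mul_le_mul' ?_ (H n)
          rw [Real.enorm_eq_ofReal hcn]
          exact ENNReal.ofReal_le_ofReal (Hb _ (hlam n))
      _ = ENNReal.ofReal (b * C) := by
          rw [← ENNReal.ofReal_mul (by positivity), Real.rpow_neg hl.le]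
          congr 1
          field_simp
  set K : ℝ≥0∞ := ENNReal.ofReal B * ENNReal.ofReal (b * C) ^ 2 with hK
  have hKtop : K ≠ ⊤ := by
    rw [hK]
    exact ENNReal.mul_ne_top ENNReal.ofReal_ne_top (ENNReal.pow_ne_top ENNReal.ofReal_ne_top)
  have bound := eLpNorm_sum_weightedMode_sq_le (φ := φ) hΨ hB hD
  refine ⟨Real.sqrt K.toReal + 1, by positivity, fun f => ?_⟩
  set a : ℕ → ℂ := fun n => φ.repr f n with ha
  have hmem : ∀ n, MemLp (fun z => ((c n : ℂ) * a n) * weightedMode φ lam Ψ n z) 2 spaceTime := by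
    intro n
    refine ⟨(stronglyMeasurable_const.mul
      (stronglyMeasurable_weightedMode hΨ n)).aestronglyMeasurable, ?_⟩
    have h1 := bound {n} a
    simp only [Finset.sum_singleton] at h1
    have h2 : K * ‖a n‖ₑ ^ 2 < ⊤ :=
      ENNReal.mul_lt_top hKtop.lt_top (ENNReal.pow_lt_top enorm_lt_top)
    by_contra h3
    rw [not_lt, top_le_iff] at h3
    rw [h3] at h1
    simp at h1
    exact h2.ne h1
  set T : ℕ → Lp ℂ 2 spaceTime := fun n => (hmem n).toLp with hT
  have hTcoe : ∀ s : Finset ℕ, (∑ n ∈ s, T n : Lp ℂ 2 spaceTime) =ᵐ[spaceTime]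
      fun z => ∑ n ∈ s, ((c n : ℂ) * a n) * weightedMode φ lam Ψ n z := by
    intro s
    have h1 : ∀ᵐ z ∂spaceTime, ∀ n, T n z = ((c n : ℂ) * a n) * weightedMode φ lam Ψ n z :=
      ae_all_iff.2 fun n => (hmem n).coeFn_toLp
    filter_upwards [h1, Lp.coeFn_fun_finsetSum s T] with z h1 h2
    rw [h2]
    exact Finset.sum_congr rfl fun n _ => h1 n
  have hTnorm : ∀ s : Finset ℕ, ‖∑ n ∈ s, T n‖ ^ 2 ≤ K.toReal * ∑ n ∈ s, ‖a n‖ ^ 2 := by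
    intro s
    have h1 := bound s a
    rw [← eLpNorm_congr_ae (hTcoe s), ← Lp.enorm_def] at h1
    have h2 : ∑ n ∈ s, ‖a n‖ₑ ^ 2 = ENNReal.ofReal (∑ n ∈ s, ‖a n‖ ^ 2) := by
      rw [ENNReal.ofReal_sum_of_nonneg fun n _ => sq_nonneg _]
      exact Finset.sum_congr rfl fun n _ => by
        rw [← ofReal_norm, ENNReal.ofReal_pow (norm_nonneg _)]
    rw [h2, ← hK, show K = ENNReal.ofReal K.toReal from (ENNReal.ofReal_toReal hKtop).symm,
      ← ENNReal.ofReal_mul ENNReal.toReal_nonneg,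
      ← ofReal_norm, ← ENNReal.ofReal_pow (norm_nonneg _)] at h1
    exact (ENNReal.ofReal_le_ofReal_iff (mul_nonneg ENNReal.toReal_nonneg
      (Finset.sum_nonneg fun n _ => sq_nonneg _))).1 h1
  have hale : ∀ s : Finset ℕ, ∑ n ∈ s, ‖a n‖ ^ 2 ≤ ‖f‖ ^ 2 := by
    intro s
    have := lp.sum_rpow_le_norm_rpow (p := 2) (by norm_num) (φ.repr f) s
    simpa using this
  have hasum : Summable fun n => ‖a n‖ ^ 2 :=
    summable_of_sum_le (fun n => sq_nonneg _) hale
  have hTs : Summable T := by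
    rw [summable_iff_vanishing_norm]
    intro ε hε
    obtain ⟨s, hs⟩ := summable_iff_vanishing_norm.1 (hasum.mul_left K.toReal) (ε ^ 2)
      (by positivity)
    refine ⟨s, fun t ht => ?_⟩
    have h1 := (le_abs_self _).trans_lt (hs t ht)
    rw [← Finset.mul_sum] at h1
    exact lt_of_pow_lt_pow_left₀ 2 hε.le ((hTnorm t).trans_lt h1)
  set S : Lp ℂ 2 spaceTime := ∑' n, T n with hS
  have hSnorm : ‖S‖ ≤ Real.sqrt K.toReal * ‖f‖ := by
    refine le_of_tendsto hTs.hasSum.norm (Eventually.of_forall fun s => ?_)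
    refine le_of_sq_le_sq ?_ (by positivity)
    rw [mul_pow, Real.sq_sqrt ENNReal.toReal_nonneg]
    exact (hTnorm s).trans (mul_le_mul_of_nonneg_left (hale s) ENNReal.toReal_nonneg)
  have hSm : AEStronglyMeasurable (Function.uncurry fun t x => S (t, x)) spaceTime :=
    Lp.aestronglyMeasurable S
  refine ⟨fun t x => S (t, x), ⟨hSm, ?_⟩, ?_⟩
  · have h1 := (Lp.tendsto_Lp_iff_tendsto_eLpNorm' _ _).1 hTs.hasSum
    have h2 := ENNReal.Tendsto.pow (n := 2) h1
    rw [zero_pow two_ne_zero] at h2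
    refine h2.congr fun s => ?_
    have hm : StronglyMeasurable fun z => ∑ n ∈ s, ((c n : ℂ) * a n) * weightedMode φ lam Ψ n z :=
      Finset.stronglyMeasurable_fun_sum s fun n _ =>
        stronglyMeasurable_const.mul (stronglyMeasurable_weightedMode hΨ n)
    simp_rw [mul_partialFlow]
    rw [lintegral_eLpNorm_sq (F := fun t x =>
      (∑ n ∈ s, ((c n : ℂ) * a n) * weightedMode φ lam Ψ n (t, x)) - S (t, x))
      (hm.aestronglyMeasurable.sub hSm)]
    congr 1
    refine eLpNorm_congr_ae ?_
    filter_upwards [hTcoe s] with z hz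
    rw [Pi.sub_apply, hz]
    rfl
  · rw [lintegral_eLpNorm_sq hSm, ← ENNReal.rpow_natCast, ← ENNReal.rpow_mul]
    have h1 : eLpNorm (Function.uncurry fun t x => S (t, x)) 2 spaceTime = ENNReal.ofReal ‖S‖ := by
      rw [ofReal_norm, Lp.enorm_def]
      rfl
    rw [h1, show ((2 : ℕ) : ℝ) * (1 / 2) = 1 by norm_num, ENNReal.rpow_one]
    refine ENNReal.ofReal_le_ofReal (hSnorm.trans ?_)
    nlinarith [norm_nonneg f]

end Equivalence

end Smoothing

theorem corollaryA2 (V : ℝ → ℝ) (k : ℝ)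
    (hV : Smoothing.IsConfining V k) (hVk : Smoothing.IsAsymptoticToPower V k)
    (φ : HilbertBasis ℕ ℂ Smoothing.L2) (lam : ℕ → ℝ)
    (hφ : Smoothing.IsEigenbasis V φ lam)
    (γ : ℝ) (hγ : 0 < γ) (Ψ : ℝ → ℝ) (hΨ : Continuous Ψ) :
    Smoothing.SmoothingEstimate φ lam γ Ψ ↔ Smoothing.EigenfunctionDecay φ lam γ Ψ := by
  obtain ⟨c, hc, hlam⟩ := hφ.exists_lam_lower_bound hV hVk
  obtain ⟨δ, hδ, hwin⟩ := hφ.exists_window hV hVk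
  obtain ⟨G, hG⟩ := Smoothing.exists_sum_gaussian_le (fun n => sq_nonneg (lam n)) hδ hwin
  obtain ⟨B, hB⟩ := Smoothing.exists_exponential_sum_bound hG
  exact ⟨fun h => h.eigenfunctionDecay hΨ hγ fun n => hc.trans_le (hlam n),
    fun h => h.smoothingEstimate hΨ hγ hc hlam hB⟩
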